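/- Let $\mathcal V=\{o\}\cup\bigcup_{n\ge 1}\{1,2,\dots\}^n$, where the parent of $(v_1,\dots,v_n)$ is $(v_1,\dots,v_{n-1})$ (the root $o$ if $n=1$). A tree is identified with its vertex set $T\subseteq\mathcal V$, random trees are random elements of $\{0,1\}^{\mathcal V}$ with the product $\sigma$-algebra, and $T\subseteq T'$ means inclusion of vertex sets. Let $\mathcal F$ be the set of plane trees, that is, of all $T\subseteq\mathcal V$ such that $o\in T$, the parent of each $v\in T\setminus\{o\}$ is in $T$, and $(v_1,\dots,v_n-1)\in T$ whenever $(v_1,\dots,v_n)\in T$ and $v_n\ge 2$. For $1\le k<\infty$ let $\mathcal T_k$ be the uniform distribution on the trees in $\mathcal F$ with exactly $k$ vertices. For $p\in(0,1)$ let $(X_v)_{v\in\mathcal V}$ be i.i.d. with $\mathbb P(X_v=k)=p^k(1-p)$, $k=0,1,2,\dots$, and let $T(p)$ be the Galton–Watson tree that contains $o$ and in which each vertex $v$ has exactly the children $(v,1),\dots,(v,X_v)$. For $\tfrac12\le p\le 1$ the random tree $T_\infty(p)$, with distribution $\mathcal T_\infty(p)$, is defined as follows. - For $\tfrac12<p<1$,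 $\mathcal T_\infty(p)$ is the distribution of $T(p)$ conditioned on the event that $T(p)$ is infinite. - For $p=1$, $T_\infty(1)=\mathcal V$ (every vertex has infinitely many children). - For $p=\tfrac12$, $T_\infty(1/2)=\bigcup_{k\ge1}T_k$, where $(T_k)_{k\ge1}$ is a Luczak–Winkler coupling, that is, random trees on one probability space with $T_k\sim\mathcal T_k$ for every $k\geq 1$ and $\mathbb P(T_1\subseteq T_2\subseteq\cdots)=1$. **Theorem.** Let $\tfrac12\le p_1<p_2\le 1$. The distributions $\mathcal T_\infty(p_1)$ and $\mathcal T_\infty(p_2)$ exist (that is, if $p_1=\tfrac12$, a Luczak–Winkler coupling exists), and there is a coupling of $T_\infty(p_1)\sim\mathcal T_\infty(p_1)$ and $T_\infty(p_2)\sim\mathcal T_\infty(p_2)$ such that $$\mathbb P\big(T_\infty(p_1)\subseteq T_\infty(p_2)\big)=1;$$ if $p_1=\tfrac12$, this holds whichever Luczak–Winkler coupling is used to define $T_\infty(1/2)$. -/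

import Mathlib

open MeasureTheory ProbabilityTheory
open scoped ENNReal

noncomputable section

namespace GWTree

/-- The vertices of the Ulam-Harris tree `𝒱 = {o} ∪ ⋃ n ≥ 1, {1, 2, …} ^ n`. Children are
numbered from `0` instead of `1`: the vertex `(v₁, …, vₙ)` is the list `[v₁ - 1, …, vₙ - 1]`, the
root `o` is `[]`, and `v ++ [i]` is the `(i + 1)`-st child of `v`. -/
abbrev Vertex : Type := List ℕ

/-- A tree is identified with its vertex set, so that `T ⊆ T'` is inclusion of vertex sets. Sets of
vertices carry the product `σ`-algebra of `{0, 1} ^ 𝒱`. -/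
abbrev VertexSet : Type := Set Vertex

/-- The class `ℱ` of rooted ordered (plane) trees: sets of vertices that contain the root, that
contain the parent of each of their vertices (that is, they are connected), and that contain the
youngest older sibling of each of their vertices that has an older sibling. -/
structure IsPlaneTree (T : VertexSet) : Prop where
  root_mem : [] ∈ T
  parent_mem : ∀ (v : Vertex) (i : ℕ), v ++ [i] ∈ T → v ∈ T
  sibling_mem : ∀ (v : Vertex) (i : ℕ), v ++ [i + 1] ∈ T → v ++ [i] ∈ T

/-- The plane trees with exactly `k` vertices. -/
def planeTreesOfSize (k : ℕ) : Set VertexSet :=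
  {T | IsPlaneTree T ∧ T.encard = k}

/-- `𝒯ₖ`: the uniform distribution on the plane trees with exactly `k` vertices. -/
def uniformTreeLaw (k : ℕ) : Measure VertexSet :=
  uniformOn (planeTreesOfSize k)

/-- The geometric offspring distribution, which gives mass `p ^ k * (1 - p)` to `k = 0, 1, 2, …`,
used for `0 < p < 1`. -/
def offspringLaw (p : ℝ) : Measure ℕ :=
  Measure.sum fun k : ℕ => ENNReal.ofReal (p ^ k * (1 - p)) • Measure.dirac k

/-- This is Mathlib's geometric distribution with success probability `1 - p`. -/
theorem offspringLaw_eq_geometricMeasure (p : unitInterval) (hp : p ≠ 1) :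
    offspringLaw p = geometricMeasure (unitInterval.symm p) := by
  rw [geometricMeasure_eq (by simpa [unitInterval.symm_eq_zero] using hp)]
  simp [offspringLaw]

/-- Generation `n` of the tree in which the vertex `v` has `X v` children. -/
def generation (X : Vertex → ℕ) : ℕ → VertexSet
  | 0 => {[]}
  | n + 1 => ⋃ v ∈ generation X n, ⋃ i ∈ Set.Iio (X v), {v ++ [i]}

/-- The tree in which the vertex `v` has `X v` children. -/
def treeOf (X : Vertex → ℕ) : VertexSet :=
  ⋃ n, generation X n

/-- The law of the Galton-Watson tree `T(p)`: the offspring numbers `(X v)` are i.i.d. with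
distribution `offspringLaw p`. -/
def galtonWatsonLaw (p : ℝ) : Measure VertexSet :=
  (Measure.infinitePi fun _ : Vertex => offspringLaw p).map treeOf

/-- `π` is the joint law of a Luczak-Winkler coupling `(T k)_{k ≥ 1}`: each `T k` is a uniform
plane tree of size `k`, and almost surely `T 1 ⊆ T 2 ⊆ ⋯`. The coordinate `T 0` is not used. -/
structure IsLuczakWinklerCoupling (π : Measure (ℕ → VertexSet)) : Prop where
  marginal : ∀ k : ℕ, 1 ≤ k → π.map (fun T => T k) = uniformTreeLaw k
  increasing : ∀ᵐ T ∂π, ∀ k : ℕ, 1 ≤ k → T k ⊆ T (k + 1)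

/-- `ν` is the distribution `𝒯_∞(p)` of `T_∞(p)`, for `1/2 ≤ p ≤ 1`:
* `T_∞(1/2)` is the union of the trees of a Luczak-Winkler coupling;
* for `1/2 < p < 1`, `T_∞(p)` is `T(p)` conditioned on the event that it is infinite, an event of
  positive probability;
* for `p = 1` every offspring number is infinite (`X v ≥ k` has probability `p ^ k = 1` for every
  `k`), so that `T_∞(1)` is the whole tree `𝒱`. -/
def IsTInftyLaw (p : ℝ) (ν : Measure VertexSet) : Prop :=
  (p = 1 / 2 ∧ ∃ π : Measure (ℕ → VertexSet), IsLuczakWinklerCoupling π ∧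
      ν = π.map fun T => ⋃ (k : ℕ) (_ : 1 ≤ k), T k) ∨
    (1 / 2 < p ∧ p < 1 ∧ ν = (galtonWatsonLaw p)[|{T : VertexSet | T.Infinite}]) ∨
    (p = 1 ∧ ν = Measure.dirac Set.univ)

/-- `γ` is the joint law of a coupling `(T, T')` of random trees with laws `ν` and `ν'` such that
almost surely `T ⊆ T'`. -/
structure IsMonotoneCoupling (γ : Measure (VertexSet × VertexSet)) (ν ν' : Measure VertexSet) :
    Prop where
  isProbabilityMeasure : IsProbabilityMeasure γ
  map_fst : γ.map Prod.fst = ν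
  map_snd : γ.map Prod.snd = ν'
  subset : ∀ᵐ T ∂γ, T.1 ⊆ T.2

end GWTree

end

/-! Reading left children as first children and right children as next siblings turns finite plane
trees with k vertices into binary trees with k - 1 nodes (`toSet`). A uniform binary tree can be
grown from the root: given its size, draw the size of the left subtree from the Catalan law
`splitProb`, then continue independently on both sides. A Galton–Watson tree with 1/2 < p < 1,
conditioned to be infinite, grows in the same way from the size `⊤`: with probability
`finiteSplitProb p l` the left subtree has l nodes and the right one is infinite, likewise with the
sides exchanged, and with probability 2p - 1 both are infinite.

All these trees are built from the same uniform labels on the infinite binary tree, so inclusion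
follows once the pair of subtree sizes is monotone in the size and in p for each fixed label
(`split_mono`, `randomTree_mono`). Between finite sizes this is log-convexity of the Catalan
numbers: under the quantile coupling, one more node raises the left size by 0 or 1. At size `⊤`, the
value l occupies an interval that starts at `limitCdf l` and shrinks as p grows; all other labels
give `⊤`. The right size uses 1 - u in place of u. The bound `limitCdf_le_half` keeps the two sizes
from both being finite, and `limitCdf_le_splitCdf` compares finite with infinite trees.

The laws are identified by `map_randomTree` and, through the probabilities of containing a finite
plane tree, by `cond_galtonWatsonLaw`. For p = 1/2 the law of the union of a Luczak–Winkler coupling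
depends only on its marginals (`IsLuczakWinklerCoupling.map_iUnion_eq`), so the coupling built here
represents all of them. -/

noncomputable section

namespace GWTree

/-! ### Plane trees and binary trees -/

/-- The plane tree whose first subtree is `A` and which becomes `B` after the removal of that
subtree. -/
def nodeSet (A B : VertexSet) : VertexSet :=
  {v | match v with
    | [] => True
    | 0 :: w => w ∈ A
    | (i + 1) :: w => i :: w ∈ B}

section nodeSet

variable {A A' B B' T : VertexSet}

@[simp] theorem nil_mem_nodeSet : [] ∈ nodeSet A B := trivial

@[simp] theorem zero_cons_mem_nodeSet {w : Vertex} : 0 :: w ∈ nodeSet A B ↔ w ∈ A := Iff.rfl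

@[simp] theorem succ_cons_mem_nodeSet {i : ℕ} {w : Vertex} :
    (i + 1) :: w ∈ nodeSet A B ↔ i :: w ∈ B := Iff.rfl

/-- The hypothesis is needed because `nodeSet` does not record whether its second argument contains
the root. -/
theorem nodeSet_subset_nodeSet (hB' : [] ∈ B') :
    nodeSet A B ⊆ nodeSet A' B' ↔ A ⊆ A' ∧ B ⊆ B' := by
  constructor
  · intro h
    refine ⟨fun w hw => zero_cons_mem_nodeSet.1 (h (zero_cons_mem_nodeSet.2 hw)), fun v hv => ?_⟩
    match v with
    | [] => exact hB'
    | i :: w => exact succ_cons_mem_nodeSet.1 (h (succ_cons_mem_nodeSet.2 hv))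
  · rintro ⟨hA, hB⟩ v hv
    match v with
    | [] => trivial
    | 0 :: w => exact hA hv
    | (i + 1) :: w => exact hB hv

theorem nodeSet_inj (hB : [] ∈ B) (hB' : [] ∈ B') :
    nodeSet A B = nodeSet A' B' ↔ A = A' ∧ B = B' := by
  simp only [Set.Subset.antisymm_iff, nodeSet_subset_nodeSet hB, nodeSet_subset_nodeSet hB']
  tauto

theorem nodeSet_ne_singleton (hA : [] ∈ A) : nodeSet A B ≠ {[]} := by
  intro h
  have : [0] ∈ nodeSet A B := hA
  simp [h] at this

theorem encard_nodeSet (hB : [] ∈ B) : (nodeSet A B).encard = A.encard + B.encard := by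
  -- The root of `B` becomes the root of the whole tree, and its other vertices move one sibling to
  -- the right; so no vertex is gained or lost.
  let shift : Vertex → Vertex := fun v => match v with
    | [] => []
    | i :: w => (i + 1) :: w
  have hshift : Function.Injective shift := by
    intro v v' h
    match v, v' with
    | [], [] => rfl
    | [], _ :: _ => simp [shift] at h
    | _ :: _, [] => simp [shift] at h
    | _ :: _, _ :: _ => simpa [shift] using h
  have h : nodeSet A B = (List.cons 0 '' A) ∪ shift '' B := by
    ext v
    constructor
    · intro hv
      match v with
      | [] => exact Or.inr ⟨[], hB, rfl⟩
      | 0 :: w => exact Or.inl ⟨w, hv, rfl⟩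
      | (i + 1) :: w => exact Or.inr ⟨i :: w, hv, rfl⟩
    · rintro (⟨w, hw, rfl⟩ | ⟨w, hw, rfl⟩)
      · exact hw
      · match w with
        | [] => trivial
        | i :: w => exact hw
  rw [h, Set.encard_union_eq, List.cons_injective.encard_image, hshift.encard_image]
  rw [Set.disjoint_left]
  rintro _ ⟨w, -, rfl⟩ ⟨v, -, hv⟩
  match v with
  | [] => simp [shift] at hv
  | i :: w => simp [shift] at hv

theorem isPlaneTree_singleton : IsPlaneTree {[]} where
  root_mem := rfl
  parent_mem v i h := by simp at h
  sibling_mem v i h := by simp at h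

theorem IsPlaneTree.nodeSet (hA : IsPlaneTree A) (hB : IsPlaneTree B) :
    IsPlaneTree (nodeSet A B) where
  root_mem := trivial
  parent_mem v i h := by
    match v with
    | [] => trivial
    | 0 :: w => exact hA.parent_mem w i h
    | (j + 1) :: w => exact hB.parent_mem (j :: w) i h
  sibling_mem v i h := by
    match v, i with
    | [], 0 => exact hA.root_mem
    | [], j + 1 => exact hB.sibling_mem [] j h
    | 0 :: w, i => exact hA.sibling_mem w i h
    | (j + 1) :: w, i => exact hB.sibling_mem (j :: w) i h

theorem IsPlaneTree.mem_of_append_mem (hT : IsPlaneTree T) {v w : Vertex} (h : v ++ w ∈ T) :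
    v ∈ T := by
  induction w using List.reverseRecOn with
  | nil => simpa using h
  | append_singleton w i ih => exact ih (hT.parent_mem _ i (by simpa using h))

theorem IsPlaneTree.mem_of_le (hT : IsPlaneTree T) {v : Vertex} {i j : ℕ} (hij : i ≤ j)
    (h : v ++ [j] ∈ T) : v ++ [i] ∈ T := by
  induction j, hij using Nat.le_induction with
  | base => exact h
  | succ j _ ih => exact ih (hT.sibling_mem _ _ h)

/-- A plane tree is a single vertex, or it has a first subtree. -/
theorem IsPlaneTree.eq_singleton_or_eq_nodeSet (hT : IsPlaneTree T) :
    T = {[]} ∨ ∃ A B, IsPlaneTree A ∧ IsPlaneTree B ∧ T = GWTree.nodeSet A B := by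
  by_cases h0 : [0] ∈ T
  · right
    refine ⟨{w | 0 :: w ∈ T}, {v | match v with | [] => True | i :: w => (i + 1) :: w ∈ T},
      ⟨h0, fun v i h => hT.parent_mem (0 :: v) i h, fun v i h => hT.sibling_mem (0 :: v) i h⟩,
      ⟨trivial, fun v i h => ?_, fun v i h => ?_⟩, ?_⟩
    · match v with
      | [] => trivial
      | j :: w => exact hT.parent_mem ((j + 1) :: w) i h
    · match v with
      | [] => exact hT.sibling_mem [] (i + 1) h
      | j :: w => exact hT.sibling_mem ((j + 1) :: w) i h
    · ext v
      match v with
      | [] => simpa using hT.root_mem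
      | 0 :: w => simp
      | (i + 1) :: w => simp
  · left
    refine Set.Subset.antisymm (fun v hv => ?_) (by simpa using hT.root_mem)
    match v with
    | [] => rfl
    | i :: w =>
      have hi : [] ++ [i] ∈ T := hT.mem_of_append_mem (v := [i]) (w := w) hv
      exact absurd (hT.mem_of_le (Nat.zero_le i) hi) h0

end nodeSet

/-- The finite plane tree that corresponds to a binary tree: left children become first children,
and right children become next siblings. -/
def toSet : BinaryTree Unit → VertexSet
  | .nil => {[]}
  | .node _ a b => nodeSet (toSet a) (toSet b)

theorem isPlaneTree_toSet (t : BinaryTree Unit) : IsPlaneTree (toSet t) := by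
  induction t with
  | nil => exact isPlaneTree_singleton
  | node _ a b ha hb => exact ha.nodeSet hb

theorem encard_toSet (t : BinaryTree Unit) : (toSet t).encard = (t.numNodes + 1 : ℕ) := by
  induction t with
  | nil => simp [toSet]
  | node _ a b ha hb =>
    rw [toSet, encard_nodeSet (isPlaneTree_toSet b).root_mem, ha, hb, BinaryTree.numNodes]
    norm_cast
    ring

theorem finite_toSet (t : BinaryTree Unit) : (toSet t).Finite :=
  Set.finite_of_encard_eq_coe (encard_toSet t)

theorem toSet_injective : Function.Injective toSet := by
  intro t
  induction t with
  | nil =>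
    intro t' h
    cases t' with
    | nil => rfl
    | node _ a b => exact absurd h.symm (nodeSet_ne_singleton (isPlaneTree_toSet a).root_mem)
  | node _ a b ha hb =>
    intro t' h
    cases t' with
    | nil => exact absurd h (nodeSet_ne_singleton (isPlaneTree_toSet a).root_mem)
    | node _ a' b' =>
      obtain ⟨h1, h2⟩ := (nodeSet_inj (isPlaneTree_toSet b).root_mem
        (isPlaneTree_toSet b').root_mem).1 h
      rw [ha h1, hb h2]

theorem IsPlaneTree.exists_toSet_eq {T : VertexSet} (hT : IsPlaneTree T) (hfin : T.Finite) :
    ∃ t, toSet t = T := by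
  obtain ⟨n, hn⟩ := hfin.exists_encard_eq_coe
  induction n using Nat.strong_induction_on generalizing T with
  | _ n ih =>
    obtain rfl | ⟨A, B, hA, hB, rfl⟩ := hT.eq_singleton_or_eq_nodeSet
    · exact ⟨.nil, rfl⟩
    · rw [encard_nodeSet hB.root_mem] at hn
      have hAf : A.Finite := Set.encard_ne_top_iff.1 fun h => by simp [h] at hn
      have hBf : B.Finite := Set.encard_ne_top_iff.1 fun h => by simp [h] at hn
      obtain ⟨a, ha⟩ := hAf.exists_encard_eq_coe
      obtain ⟨b, hb⟩ := hBf.exists_encard_eq_coe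
      -- Both parts contain a root, so each is strictly smaller than the whole and the induction
      -- applies.
      have ha0 : a ≠ 0 := by
        rintro rfl
        simp only [Nat.cast_zero, Set.encard_eq_zero] at ha
        exact (ha ▸ hA.root_mem : [] ∈ (∅ : VertexSet))
      have hb0 : b ≠ 0 := by
        rintro rfl
        simp only [Nat.cast_zero, Set.encard_eq_zero] at hb
        exact (hb ▸ hB.root_mem : [] ∈ (∅ : VertexSet))
      have hab : a + b = n := by
        rw [ha, hb] at hn
        exact_mod_cast hn
      obtain ⟨s, rfl⟩ := ih a (by omega) hA hAf ha
      obtain ⟨t, rfl⟩ := ih b (by omega) hB hBf hb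
      exact ⟨.node () s t, rfl⟩

theorem planeTreesOfSize_succ (n : ℕ) :
    planeTreesOfSize (n + 1) = toSet '' BinaryTree.treesOfNumNodesEq n := by
  ext T
  constructor
  · rintro ⟨hT, hcard⟩
    obtain ⟨t, rfl⟩ := hT.exists_toSet_eq (Set.finite_of_encard_eq_coe hcard)
    rw [encard_toSet] at hcard
    refine ⟨t, ?_, rfl⟩
    simp only [BinaryTree.coe_treesOfNumNodesEq, Set.mem_ofPred_eq]
    have : t.numNodes + 1 = n + 1 := by exact_mod_cast hcard
    omega
  · rintro ⟨t, ht, rfl⟩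
    simp only [BinaryTree.coe_treesOfNumNodesEq, Set.mem_ofPred_eq] at ht
    exact ⟨isPlaneTree_toSet t, by rw [encard_toSet, ht]⟩

/-! ### Containment events and the laws they determine -/

theorem exists_toSet_subset_iff_mem (v : Vertex) :
    ∃ t, ∀ T, IsPlaneTree T → (toSet t ⊆ T ↔ v ∈ T) := by
  match v with
  | [] => exact ⟨.nil, fun T hT => by simp [toSet]⟩
  | 0 :: w =>
    obtain ⟨t, ht⟩ := exists_toSet_subset_iff_mem w
    refine ⟨.node () t .nil, fun T hT => ?_⟩
    obtain rfl | ⟨A, B, hA, hB, rfl⟩ := hT.eq_singleton_or_eq_nodeSet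
    · simp only [Set.mem_singleton_iff, List.cons_ne_nil, iff_false]
      exact fun h => absurd (h (isPlaneTree_toSet t).root_mem : [0] ∈ ({[]} : VertexSet)) (by simp)
    · simp [toSet, nodeSet_subset_nodeSet hB.root_mem, ht A hA, hB.root_mem]
  | (i + 1) :: w =>
    obtain ⟨t, ht⟩ := exists_toSet_subset_iff_mem (i :: w)
    refine ⟨.node () .nil t, fun T hT => ?_⟩
    obtain rfl | ⟨A, B, hA, hB, rfl⟩ := hT.eq_singleton_or_eq_nodeSet
    · simp only [Set.mem_singleton_iff, List.cons_ne_nil, iff_false]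
      exact fun h => absurd (h rfl : [0] ∈ ({[]} : VertexSet)) (by simp)
    · simp [toSet, nodeSet_subset_nodeSet hB.root_mem, ht B hB, hA.root_mem]
-- This is the depth of the vertex in the binary encoding: a step to a first child or to a next
-- sibling costs one.
termination_by v.sum + v.length

/-- The witness is the union of the two trees, formed by overlaying the binary trees from the root.
-/
theorem exists_toSet_subset_iff_and (s t : BinaryTree Unit) :
    ∃ r, ∀ T, IsPlaneTree T → (toSet r ⊆ T ↔ toSet s ⊆ T ∧ toSet t ⊆ T) := by
  induction s generalizing t with
  | nil => exact ⟨t, fun T hT => by simp [toSet, hT.root_mem]⟩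
  | node _ a b ha hb =>
    cases t with
    | nil => exact ⟨.node () a b, fun T hT => by simp [toSet, hT.root_mem]⟩
    | node _ a' b' =>
      obtain ⟨c, hc⟩ := ha a'
      obtain ⟨d, hd⟩ := hb b'
      refine ⟨.node () c d, fun T hT => ?_⟩
      obtain rfl | ⟨A, B, hA, hB, rfl⟩ := hT.eq_singleton_or_eq_nodeSet
      · have key (x y : BinaryTree Unit) : ¬ toSet (.node () x y) ⊆ {[]} := fun h =>
          absurd (h (isPlaneTree_toSet x).root_mem : [0] ∈ ({[]} : VertexSet)) (by simp)
        simp [key]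
      · simp only [toSet, nodeSet_subset_nodeSet hB.root_mem, hc A hA, hd B hB]
        tauto

/-- On plane trees, containing a given finite set is containing a given finite plane tree. -/
theorem exists_toSet_subset_iff_subset (F : Finset Vertex) :
    ∃ t, ∀ T, IsPlaneTree T → (toSet t ⊆ T ↔ (F : VertexSet) ⊆ T) := by
  classical
  induction F using Finset.induction_on with
  | empty => exact ⟨.nil, fun T hT => by simp [toSet, hT.root_mem]⟩
  | insert v F _ ih =>
    obtain ⟨s, hs⟩ := exists_toSet_subset_iff_mem v
    obtain ⟨t, ht⟩ := ih
    obtain ⟨r, hr⟩ := exists_toSet_subset_iff_and s t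
    exact ⟨r, fun T hT => by rw [hr T hT, hs T hT, ht T hT]; simp [Set.insert_subset_iff]⟩

theorem measurableSet_subset (F : Finset Vertex) :
    MeasurableSet {T : VertexSet | (F : VertexSet) ⊆ T} := by
  have : {T : VertexSet | (F : VertexSet) ⊆ T} = ⋂ v ∈ F, {T | v ∈ T} := by
    ext T
    simp [Set.subset_def]
  rw [this]
  exact F.measurableSet_biInter fun v _ => measurableSet_mem v

theorem measurableSet_toSet_subset (t : BinaryTree Unit) :
    MeasurableSet {T : VertexSet | toSet t ⊆ T} := by
  simpa using measurableSet_subset (finite_toSet t).toFinset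

theorem measurableSet_isPlaneTree : MeasurableSet {T : VertexSet | IsPlaneTree T} := by
  have : {T : VertexSet | IsPlaneTree T} = {T : VertexSet | [] ∈ T ∧
      (∀ v i, v ++ [i] ∈ T → v ∈ T) ∧ ∀ v i, v ++ [i + 1] ∈ T → v ++ [i] ∈ T} := by
    ext T
    exact ⟨fun h => ⟨h.1, h.2, h.3⟩, fun h => ⟨h.1, h.2.1, h.2.2⟩⟩
  rw [this, measurableSet_setOfPred]
  fun_prop

theorem measurableSet_finite : MeasurableSet {T : VertexSet | T.Finite} :=
  (Set.Countable.ofPred_finite (α := Vertex)).measurableSet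

theorem measurableSet_infinite : MeasurableSet {T : VertexSet | T.Infinite} :=
  measurableSet_finite.compl

/-- The law of a random vertex set is determined by the probabilities of containing a finite set. -/
theorem ext_of_subset {μ ν : Measure VertexSet} [IsFiniteMeasure μ]
    (h : ∀ F : Finset Vertex,
      μ {T | (F : VertexSet) ⊆ T} = ν {T | (F : VertexSet) ⊆ T}) : μ = ν := by
  classical
  let C : Set (Set VertexSet) := Set.range fun F : Finset Vertex => {T | (F : VertexSet) ⊆ T}
  refine ext_of_generate_finite C (le_antisymm ?_ ?_) ?_ ?_ ?_
  -- If the identity is measurable from the σ-algebra generated by `C` to the product σ-algebra, the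
  -- latter is contained in the former; singletons `F` give the coordinates.
  · have hid : @Measurable VertexSet VertexSet (MeasurableSpace.generateFrom C) _ id := by
      refine (@measurable_set_iff _ _ (MeasurableSpace.generateFrom C) id).2 fun v => ?_
      refine (@measurableSet_setOfPred _ (MeasurableSpace.generateFrom C) _).1 ?_
      exact MeasurableSpace.measurableSet_generateFrom ⟨{v}, by simp⟩
    intro s hs
    exact hid hs
  · refine MeasurableSpace.generateFrom_le ?_
    rintro _ ⟨F, rfl⟩
    exact measurableSet_subset F
  · rintro _ ⟨F, rfl⟩ _ ⟨G, rfl⟩ -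
    refine ⟨F ∪ G, ?_⟩
    ext T
    simp
  · rintro _ ⟨F, rfl⟩
    exact h F
  · simpa using h ∅

/-- The law of a random plane tree is determined by the probabilities of containing a finite plane
tree. -/
theorem ext_of_toSet_subset {μ ν : Measure VertexSet} [IsFiniteMeasure μ]
    (hμ : ∀ᵐ T ∂μ, IsPlaneTree T) (hν : ∀ᵐ T ∂ν, IsPlaneTree T)
    (h : ∀ t, μ {T | toSet t ⊆ T} = ν {T | toSet t ⊆ T}) : μ = ν := by
  refine ext_of_subset fun F => ?_
  obtain ⟨t, ht⟩ := exists_toSet_subset_iff_subset F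
  have key {ρ : Measure VertexSet} (hρ : ∀ᵐ T ∂ρ, IsPlaneTree T) :
      ρ {T | (F : VertexSet) ⊆ T} = ρ {T | toSet t ⊆ T} := by
    refine measure_congr ?_
    filter_upwards [hρ] with T hT
    exact propext (ht T hT).symm
  rw [key hμ, key hν, h]

/-! ### Trees with given offspring numbers, and Galton–Watson probabilities -/

section treeOf

variable (X : Vertex → ℕ)

theorem nil_mem_treeOf : [] ∈ treeOf X := Set.mem_iUnion.2 ⟨0, rfl⟩

theorem append_mem_treeOf {v : Vertex} {i : ℕ} :
    v ++ [i] ∈ treeOf X ↔ v ∈ treeOf X ∧ i < X v := by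
  constructor
  · intro h
    obtain ⟨n, hn⟩ := Set.mem_iUnion.1 h
    cases n with
    | zero => simp [generation] at hn
    | succ n =>
      simp only [generation, Set.mem_iUnion, Set.mem_singleton_iff, Set.mem_Iio] at hn
      obtain ⟨w, hw, j, hj, h⟩ := hn
      obtain ⟨rfl, h'⟩ := List.append_inj' h rfl
      obtain rfl : i = j := by simpa using h'
      exact ⟨Set.mem_iUnion.2 ⟨n, hw⟩, hj⟩
  · rintro ⟨h, hi⟩
    obtain ⟨n, hn⟩ := Set.mem_iUnion.1 h
    refine Set.mem_iUnion.2 ⟨n + 1, ?_⟩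
    simp only [generation, Set.mem_iUnion, Set.mem_singleton_iff, Set.mem_Iio]
    exact ⟨v, hn, i, hi, rfl⟩

theorem isPlaneTree_treeOf : IsPlaneTree (treeOf X) where
  root_mem := nil_mem_treeOf X
  parent_mem v i h := ((append_mem_treeOf X).1 h).1
  sibling_mem v i h := by
    rw [append_mem_treeOf] at h ⊢
    exact ⟨h.1, by omega⟩

theorem measurable_treeOf : Measurable treeOf := by
  refine measurable_set_iff.2 fun v => ?_
  induction v using List.reverseRecOn with
  | nil => simp [nil_mem_treeOf]
  | append_singleton v i ih =>
    simp only [append_mem_treeOf]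
    refine ih.and (measurableSet_setOfPred.1 ?_)
    exact measurableSet_lt measurable_const (measurable_pi_apply v)

end treeOf

section degree

variable {T : VertexSet}

theorem IsPlaneTree.exists_degree (hT : IsPlaneTree T) (hfin : T.Finite) (v : Vertex) :
    ∃ d : ℕ, ∀ i, v ++ [i] ∈ T ↔ i < d := by
  classical
  have hex : ∃ d, v ++ [d] ∉ T := by
    by_contra! h
    exact Set.infinite_of_injective_forall_mem (f := fun i : ℕ => v ++ [i])
      (fun i j hij => by simpa using hij) h hfin
  refine ⟨Nat.find hex, fun i => ⟨fun h => ?_, fun h => not_not.1 (Nat.find_min hex h)⟩⟩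
  by_contra! hi
  exact Nat.find_spec hex (hT.mem_of_le hi h)

variable {d : Vertex → ℕ}

/-- Only the offspring numbers at vertices of `T` matter, so containment becomes a product event
under the i.i.d. law. -/
theorem subset_treeOf_iff (hT : IsPlaneTree T) (hd : ∀ v i, v ++ [i] ∈ T ↔ i < d v)
    (X : Vertex → ℕ) : T ⊆ treeOf X ↔ ∀ v ∈ T, d v ≤ X v := by
  constructor
  · intro h v hv
    by_contra! hlt
    exact lt_irrefl _ ((append_mem_treeOf X).1 (h ((hd v (X v)).2 hlt))).2
  · intro h v hv
    induction v using List.reverseRecOn with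
    | nil => exact nil_mem_treeOf X
    | append_singleton v i ih =>
      have hv' := hT.parent_mem v i hv
      exact (append_mem_treeOf X).2 ⟨ih hv', ((hd v i).1 hv).trans_le (h v hv')⟩

theorem treeOf_eq_iff (hT : IsPlaneTree T) (hd : ∀ v i, v ++ [i] ∈ T ↔ i < d v)
    (X : Vertex → ℕ) : treeOf X = T ↔ ∀ v ∈ T, X v = d v := by
  constructor
  · rintro rfl v hv
    refine le_antisymm ?_ ((subset_treeOf_iff hT hd X).1 subset_rfl v hv)
    by_contra! hlt
    exact lt_irrefl _ ((hd v (d v)).1 ((append_mem_treeOf X).2 ⟨hv, hlt⟩))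
  · intro h
    refine Set.Subset.antisymm (fun v hv => ?_)
      ((subset_treeOf_iff hT hd X).2 fun v hv => (h v hv).ge)
    induction v using List.reverseRecOn with
    | nil => exact hT.root_mem
    | append_singleton v i ih =>
      obtain ⟨hv', hi⟩ := (append_mem_treeOf X).1 hv
      exact (hd v i).2 (h v (ih hv') ▸ hi)

theorem sum_degree {S : Finset Vertex} (hS : IsPlaneTree (S : VertexSet))
    (hd : ∀ v i, v ++ [i] ∈ S ↔ i < d v) : ∑ v ∈ S, d v + 1 = S.card := by
  classical
  -- Every vertex except the root is a child of exactly one vertex: partition by parent, which is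
  -- `dropLast`.
  have hcard : (S.erase []).card = ∑ v ∈ S, ((S.erase []).filter fun w => w.dropLast = v).card := by
    refine Finset.card_eq_sum_card_fiberwise fun w hw => ?_
    obtain ⟨hne, hw⟩ := Finset.mem_erase.1 hw
    rw [← List.dropLast_append_getLast hne] at hw
    exact hS.parent_mem _ _ hw
  have hfiber (v : Vertex) : ((S.erase []).filter fun w => w.dropLast = v).card = d v := by
    have : ((S.erase []).filter fun w => w.dropLast = v) =
        (Finset.range (d v)).image fun i => v ++ [i] := by
      ext w
      simp only [Finset.mem_filter, Finset.mem_erase, Finset.mem_image, Finset.mem_range]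
      constructor
      · rintro ⟨⟨hne, hw⟩, rfl⟩
        exact ⟨w.getLast hne, (hd _ _).1 (by rwa [List.dropLast_append_getLast hne]),
          List.dropLast_append_getLast hne⟩
      · rintro ⟨i, hi, rfl⟩
        exact ⟨⟨by simp, (hd _ _).2 hi⟩, by simp⟩
    rw [this, Finset.card_image_of_injective _ fun i j hij => by simpa using hij,
      Finset.card_range]
  simp only [hfiber] at hcard
  rw [← hcard, Finset.card_erase_add_one hS.root_mem]

theorem exists_finset_degree_toSet (t : BinaryTree Unit) :
    ∃ (S : Finset Vertex) (d : Vertex → ℕ), (S : VertexSet) = toSet t ∧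
      (∀ v i, v ++ [i] ∈ toSet t ↔ i < d v) ∧ S.card = t.numNodes + 1 ∧
        ∑ v ∈ S, d v = t.numNodes := by
  choose d hd using (isPlaneTree_toSet t).exists_degree (finite_toSet t)
  have hS : ((finite_toSet t).toFinset : VertexSet) = toSet t := by simp
  have hcard : (finite_toSet t).toFinset.card = t.numNodes + 1 := by
    have := encard_toSet t
    rw [← hS, Set.encard_coe_eq_coe_finsetCard] at this
    exact_mod_cast this
  have hsum := sum_degree (d := d) (by rw [hS]; exact isPlaneTree_toSet t)
    fun v i => by simp [hd]
  exact ⟨_, d, hS, hd, hcard, by omega⟩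

end degree

section offspring

variable {p : ℝ}

theorem isProbabilityMeasure_offspringLaw (hp0 : 0 < p) (hp1 : p < 1) :
    IsProbabilityMeasure (offspringLaw p) := by
  have h := offspringLaw_eq_geometricMeasure ⟨p, hp0.le, hp1.le⟩ 
    (fun h => hp1.ne (congrArg Subtype.val h))
  simp only at h
  rw [h]
  infer_instance

theorem offspringLaw_singleton (p : ℝ) (k : ℕ) :
    offspringLaw p {k} = ENNReal.ofReal (p ^ k * (1 - p)) := by
  rw [offspringLaw, Measure.sum_apply _ (measurableSet_singleton k), tsum_eq_single k]
  · simp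
  · intro j hj
    simp [hj]

theorem offspringLaw_Ici (hp0 : 0 < p) (hp1 : p < 1) (k : ℕ) :
    offspringLaw p (Set.Ici k) = ENNReal.ofReal p ^ k := by
  have := isProbabilityMeasure_offspringLaw hp0 hp1
  induction k with
  | zero => simp [Set.Ici, measure_univ]
  | succ k ih =>
    have h : Set.Ici k = Set.Ici (k + 1) ∪ {k} := by
      ext j
      simp
      omega
    rw [h, measure_union (by simp) (measurableSet_singleton k), offspringLaw_singleton,
      ← ENNReal.ofReal_pow hp0.le] at ih
    have h2 : ENNReal.ofReal (p ^ k) =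
        ENNReal.ofReal (p ^ (k + 1)) + ENNReal.ofReal (p ^ k * (1 - p)) := by
      rw [← ENNReal.ofReal_add (by positivity) (mul_nonneg (by positivity) (by linarith))]
      congr 1
      ring
    rw [h2] at ih
    rw [← ENNReal.ofReal_pow hp0.le]
    exact (ENNReal.add_left_inj ENNReal.ofReal_ne_top).1 ih

end offspring

section galtonWatson

variable {p : ℝ}

theorem isProbabilityMeasure_galtonWatsonLaw (hp0 : 0 < p) (hp1 : p < 1) :
    IsProbabilityMeasure (galtonWatsonLaw p) := by
  have := isProbabilityMeasure_offspringLaw hp0 hp1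
  exact Measure.isProbabilityMeasure_map measurable_treeOf.aemeasurable

theorem ae_isPlaneTree_galtonWatsonLaw (p : ℝ) : ∀ᵐ T ∂galtonWatsonLaw p, IsPlaneTree T :=
  (ae_map_iff measurable_treeOf.aemeasurable measurableSet_isPlaneTree).2
    (ae_of_all _ isPlaneTree_treeOf)

/-- Each vertex of the tree contributes p to the power of its degree, and the degrees sum to the
number of edges, one per binary node. -/
theorem galtonWatsonLaw_toSet_subset (hp0 : 0 < p) (hp1 : p < 1) (t : BinaryTree Unit) :
    galtonWatsonLaw p {T | toSet t ⊆ T} = ENNReal.ofReal p ^ t.numNodes := by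
  have := isProbabilityMeasure_offspringLaw hp0 hp1
  obtain ⟨S, d, hS, hd, hcard, hsum⟩ := exists_finset_degree_toSet t
  have hmem (v : Vertex) : v ∈ toSet t ↔ v ∈ S := by rw [← hS, Finset.mem_coe]
  have hpre : treeOf ⁻¹' {T | toSet t ⊆ T} = Set.pi S fun v => Set.Ici (d v) := by
    ext X
    simp [subset_treeOf_iff (isPlaneTree_toSet t) hd, hmem, Set.mem_pi]
  rw [galtonWatsonLaw, Measure.map_apply measurable_treeOf (measurableSet_toSet_subset t), hpre,
    Measure.infinitePi_pi _ fun v _ => (Set.to_countable _).measurableSet]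
  simp only [offspringLaw_Ici hp0 hp1]
  rw [Finset.prod_pow_eq_pow_sum, hsum]

theorem galtonWatsonLaw_singleton (hp0 : 0 < p) (hp1 : p < 1) (t : BinaryTree Unit) :
    galtonWatsonLaw p {toSet t} =
      ENNReal.ofReal p ^ t.numNodes * ENNReal.ofReal (1 - p) ^ (t.numNodes + 1) := by
  have := isProbabilityMeasure_offspringLaw hp0 hp1
  obtain ⟨S, d, hS, hd, hcard, hsum⟩ := exists_finset_degree_toSet t
  have hmem (v : Vertex) : v ∈ toSet t ↔ v ∈ S := by rw [← hS, Finset.mem_coe]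
  have hpre : treeOf ⁻¹' {toSet t} = Set.pi S fun v => {d v} := by
    ext X
    simp [treeOf_eq_iff (isPlaneTree_toSet t) hd, hmem, Set.mem_pi]
  rw [galtonWatsonLaw, Measure.map_apply measurable_treeOf (measurableSet_singleton _), hpre,
    Measure.infinitePi_pi _ fun v _ => (Set.to_countable _).measurableSet]
  simp only [offspringLaw_singleton, ENNReal.ofReal_mul (pow_nonneg hp0.le _),
    ENNReal.ofReal_pow hp0.le]
  rw [Finset.prod_mul_distrib, Finset.prod_pow_eq_pow_sum, Finset.prod_const, hcard, hsum]

end galtonWatson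

/-! ### Growth and log-convexity of the Catalan numbers -/

section catalan

theorem catalan_pos (n : ℕ) : 0 < catalan n := by
  have h := succ_mul_catalan_eq_centralBinom n
  have h' := Nat.centralBinom_pos n
  exact Nat.pos_of_mul_pos_left (h ▸ h')

/-- The ratio of consecutive Catalan numbers, 2(2n + 1)/(n + 2), increases and stays below 4; the
bounds below rest on these two facts. -/
theorem catalan_succ_mul (n : ℕ) : (n + 2) * catalan (n + 1) = 2 * (2 * n + 1) * catalan n := by
  have h1 := succ_mul_catalan_eq_centralBinom (n + 1)
  have h2 := succ_mul_catalan_eq_centralBinom n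
  have h3 := Nat.succ_mul_centralBinom_succ n
  rw [← h1, ← h2] at h3
  exact Nat.eq_of_mul_eq_mul_left (Nat.succ_pos n) (by linarith)

theorem catalan_succ_le (n : ℕ) : catalan (n + 1) ≤ 4 * catalan n := by
  refine Nat.le_of_mul_le_mul_left ?_ (Nat.succ_pos (n + 1))
  rw [Nat.succ_eq_add_one, catalan_succ_mul]
  nlinarith [catalan_pos n]

/-- Log-convexity: the ratio of consecutive terms is nondecreasing. -/
theorem catalan_succ_mul_le {m n : ℕ} (hmn : m ≤ n) :
    catalan (m + 1) * catalan n ≤ catalan (n + 1) * catalan m := by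
  have hm := catalan_succ_mul m
  have hn := catalan_succ_mul n
  refine le_of_mul_le_mul_left (a := (m + 2) * (n + 2)) ?_
    (Nat.mul_pos (Nat.succ_pos _) (Nat.succ_pos _))
  calc (m + 2) * (n + 2) * (catalan (m + 1) * catalan n)
      = ((m + 2) * catalan (m + 1)) * ((n + 2) * catalan n) := by ring
    _ = (2 * (2 * m + 1) * (n + 2)) * (catalan m * catalan n) := by rw [hm]; ring
    _ ≤ (2 * (2 * n + 1) * (m + 2)) * (catalan m * catalan n) :=
        Nat.mul_le_mul_right _ (by nlinarith)
    _ = ((n + 2) * catalan (n + 1)) * ((m + 2) * catalan m) := by rw [hn]; ring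
    _ = (m + 2) * (n + 2) * (catalan (n + 1) * catalan m) := by ring

theorem catalan_add_le (n k : ℕ) : catalan (n + k) ≤ 4 ^ k * catalan n := by
  induction k with
  | zero => simp
  | succ k ih =>
    calc catalan (n + (k + 1)) ≤ 4 * catalan (n + k) := catalan_succ_le (n + k)
      _ ≤ 4 * (4 ^ k * catalan n) := by gcongr
      _ = _ := by ring

end catalan

/-! ### Laws of the subtree sizes -/

/-- The probability that the left subtree of a uniform binary tree with `n + 1` nodes has `l`
nodes. -/
def splitProb (n l : ℕ) : ℝ := catalan l * catalan (n - l) / catalan (n + 1)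

/-- The probability that the left subtree of a uniform binary tree with `n + 1` nodes has fewer than
`j` nodes. -/
def splitCdf (n j : ℕ) : ℝ := ∑ l ∈ Finset.range j, splitProb n l

/-- A lower bound for `splitCdf n j`, which is its limit as `n → ∞`. -/
def limitCdf (j : ℕ) : ℝ := ∑ l ∈ Finset.range j, (catalan l : ℝ) * (1 / 4) ^ (l + 1)

/-- The probability that the left subtree of the infinite binary tree with parameter `p` is finite
with `l` nodes. -/
def finiteSplitProb (p : ℝ) (l : ℕ) : ℝ := catalan l * (p * (1 - p)) ^ (l + 1)

section split

theorem splitProb_nonneg (n l : ℕ) : 0 ≤ splitProb n l := by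
  unfold splitProb
  positivity

theorem splitCdf_zero (n : ℕ) : splitCdf n 0 = 0 := by simp [splitCdf]

theorem splitCdf_succ (n j : ℕ) : splitCdf n (j + 1) = splitCdf n j + splitProb n j :=
  Finset.sum_range_succ _ _

theorem splitCdf_mono (n : ℕ) : Monotone (splitCdf n) :=
  monotone_nat_of_le_succ fun j => by
    rw [splitCdf_succ]
    linarith [splitProb_nonneg n j]

theorem splitCdf_nonneg (n j : ℕ) : 0 ≤ splitCdf n j :=
  Finset.sum_nonneg fun l _ => splitProb_nonneg n l

theorem splitCdf_self (n : ℕ) : splitCdf n (n + 1) = 1 := by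
  have h : (catalan (n + 1) : ℝ) ≠ 0 := by exact_mod_cast (catalan_pos _).ne'
  simp only [splitCdf, splitProb]
  rw [← Finset.sum_div, div_eq_one_iff_eq h, catalan_succ, Finset.sum_range]
  push_cast
  rfl

/-- The split law is symmetric under exchanging left and right, l ↦ n - l. -/
theorem splitCdf_add_splitCdf {n j : ℕ} (hj : j ≤ n + 1) :
    splitCdf n j + splitCdf n (n + 1 - j) = 1 := by
  induction j with
  | zero => simp [splitCdf_zero, splitCdf_self]
  | succ j ih =>
    have h : n + 1 - j = n + 1 - (j + 1) + 1 := by omega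
    have h2 : splitProb n (n + 1 - (j + 1)) = splitProb n j := by
      unfold splitProb
      rw [show n + 1 - (j + 1) = n - j by omega, show n - (n - j) = j by omega]
      ring
    have := ih (by omega)
    rw [h, splitCdf_succ, h2] at this
    rw [splitCdf_succ]
    linarith

theorem splitCdf_le_one {n j : ℕ} (hj : j ≤ n + 1) : splitCdf n j ≤ 1 :=
  (splitCdf_mono n hj).trans_eq (splitCdf_self n)

/-- After cancelling the common factor this compares the Catalan ratio at n - l with the one at n +
1, which is log-convexity. -/
theorem splitProb_succ_le {n l : ℕ} (hl : l ≤ n) : splitProb (n + 1) l ≤ splitProb n l := by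
  have h1 : (0 : ℝ) < catalan (n + 1) := by exact_mod_cast catalan_pos _
  have h2 : (0 : ℝ) < catalan (n + 1 + 1) := by exact_mod_cast catalan_pos _
  have h3 : (catalan (n - l + 1) : ℝ) * catalan (n + 1) ≤
      catalan (n + 1 + 1) * catalan (n - l) := by
    exact_mod_cast catalan_succ_mul_le (show n - l ≤ n + 1 by omega)
  unfold splitProb
  rw [show n + 1 - l = n - l + 1 by omega, div_le_div_iff₀ h2 h1]
  have := mul_le_mul_of_nonneg_left h3 (Nat.cast_nonneg (α := ℝ) (catalan l))
  linarith

theorem splitCdf_succ_le {n j : ℕ} (hj : j ≤ n + 1) : splitCdf (n + 1) j ≤ splitCdf n j :=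
  Finset.sum_le_sum fun l hl => splitProb_succ_le (by have := Finset.mem_range.1 hl; omega)

/-- The previous monotonicity, applied to the right subtree by symmetry. -/
theorem splitCdf_le_succ_succ {n j : ℕ} (hj : j ≤ n + 1) :
    splitCdf n j ≤ splitCdf (n + 1) (j + 1) := by
  have h1 := splitCdf_add_splitCdf hj
  have h2 := splitCdf_add_splitCdf (n := n + 1) (j := j + 1) (by omega)
  have h3 := splitCdf_succ_le (n := n) (j := n + 1 - j) (by omega)
  rw [show n + 1 + 1 - (j + 1) = n + 1 - j by omega] at h2
  linarith

theorem limitCdf_succ (j : ℕ) :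
    limitCdf (j + 1) = limitCdf j + (catalan j : ℝ) * (1 / 4) ^ (j + 1) :=
  Finset.sum_range_succ _ _

theorem limitCdf_mono : Monotone limitCdf :=
  monotone_nat_of_le_succ fun j => by
    rw [limitCdf_succ]
    have : (0 : ℝ) ≤ (catalan j : ℝ) * (1 / 4) ^ (j + 1) := by positivity
    linarith

theorem limitCdf_nonneg (j : ℕ) : 0 ≤ limitCdf j :=
  Finset.sum_nonneg fun l _ => by positivity

/-- Termwise, since l + 1 consecutive Catalan ratios have product at most 4 ^ (l + 1). -/
theorem limitCdf_le_splitCdf {n j : ℕ} (hj : j ≤ n + 1) : limitCdf j ≤ splitCdf n j := by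
  refine Finset.sum_le_sum fun l hl => ?_
  have hl' : l ≤ n := by have := Finset.mem_range.1 hl; omega
  have h : (catalan (n + 1) : ℝ) ≤ 4 ^ (l + 1) * catalan (n - l) := by
    have := catalan_add_le (n - l) (l + 1)
    rw [show n - l + (l + 1) = n + 1 by omega] at this
    exact_mod_cast this
  have h1 : (0 : ℝ) < catalan (n + 1) := by exact_mod_cast catalan_pos _
  unfold splitProb
  rw [mul_div_assoc]
  refine mul_le_mul_of_nonneg_left ?_ (Nat.cast_nonneg _)
  rw [one_div, inv_pow, ← one_div, div_le_div_iff₀ (by positivity) h1]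
  linarith

theorem limitCdf_le_half (j : ℕ) : limitCdf j ≤ 1 / 2 := by
  -- With n = 2j, the left size and, by symmetry, the right size are each below j with the same
  -- probability, and these events are disjoint.
  have h1 : limitCdf j ≤ splitCdf (2 * j) j := limitCdf_le_splitCdf (by omega)
  have h2 := splitCdf_add_splitCdf (n := 2 * j) (j := j) (by omega)
  have h3 : splitCdf (2 * j) j ≤ splitCdf (2 * j) (2 * j + 1 - j) := splitCdf_mono _ (by omega)
  linarith

variable {p q : ℝ}

theorem finiteSplitProb_nonneg (hp0 : 0 ≤ p) (hp1 : p ≤ 1) (l : ℕ) : 0 ≤ finiteSplitProb p l := by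
  have := mul_nonneg hp0 (sub_nonneg.2 hp1)
  unfold finiteSplitProb
  positivity

theorem finiteSplitProb_anti (hp : 1 / 2 ≤ p) (hpq : p ≤ q) (hq : q ≤ 1) (l : ℕ) :
    finiteSplitProb q l ≤ finiteSplitProb p l := by
  unfold finiteSplitProb
  have h1 : 0 ≤ q * (1 - q) := mul_nonneg (by linarith) (by linarith)
  have h2 : q * (1 - q) ≤ p * (1 - p) := by nlinarith
  gcongr

/-- As p(1 - p) ≤ 1/4, the interval reserved for a finite size l ends before the one for l + 1
starts. -/
theorem limitCdf_add_finiteSplitProb_le (hp0 : 0 ≤ p) (hp1 : p ≤ 1) (l : ℕ) :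
    limitCdf l + finiteSplitProb p l ≤ limitCdf (l + 1) := by
  rw [limitCdf_succ]
  unfold finiteSplitProb
  have h1 : 0 ≤ p * (1 - p) := mul_nonneg hp0 (by linarith)
  have h2 : p * (1 - p) ≤ 1 / 4 := by nlinarith [sq_nonneg (p - 1 / 2)]
  gcongr

/-- The generating function of the Catalan numbers, at `p * (1 - p)`. -/
theorem hasSum_finiteSplitProb (hp : 1 / 2 < p) (hp1 : p < 1) :
    HasSum (finiteSplitProb p) (1 - p) := by
  set z := p * (1 - p) with hz
  have hz0 : 0 < z := mul_pos (by linarith) (by linarith)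
  have hz4 : z < 1 / 4 := by nlinarith
  have hnn : ∀ n, 0 ≤ (catalan n : ℝ) * z ^ n := fun n => by positivity
  have hbound (n : ℕ) : (catalan n : ℝ) * z ^ n ≤ (4 * z) ^ n := by
    rw [mul_pow 4 z n]
    refine mul_le_mul_of_nonneg_right ?_ (pow_nonneg hz0.le n)
    have := catalan_add_le 0 n
    simp only [zero_add, catalan_zero, mul_one] at this
    exact_mod_cast this
  have hsum : Summable fun n => (catalan n : ℝ) * z ^ n :=
    Summable.of_nonneg_of_le hnn hbound
      (summable_geometric_of_lt_one (by linarith) (by linarith))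
  have hsumn : Summable fun n => ‖(catalan n : ℝ) * z ^ n‖ := by
    simpa only [Real.norm_of_nonneg (hnn _)] using hsum
  set c := ∑' n, (catalan n : ℝ) * z ^ n with hc
  have hsq : c * c = ∑' n, (catalan (n + 1) : ℝ) * z ^ n := by
    rw [hc, tsum_mul_tsum_eq_tsum_sum_antidiagonal_of_summable_norm hsumn hsumn]
    refine tsum_congr fun n => ?_
    rw [catalan_succ']
    push_cast
    rw [Finset.sum_mul]
    refine Finset.sum_congr rfl fun ij hij => ?_
    rw [← Finset.HasAntidiagonal.mem_antidiagonal.1 hij, pow_add]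
    ring
  have hrec : c = 1 + z * (c * c) := by
    rw [hsq, hc, hsum.tsum_eq_zero_add, ← tsum_mul_left]
    simp only [catalan_zero, pow_zero, Nat.cast_one, mul_one]
    congr 1
    refine tsum_congr fun n => ?_
    ring
  have hS : HasSum (finiteSplitProb p) (z * c) := by
    have h : finiteSplitProb p = fun n => z * (catalan n * z ^ n) := by
      ext n
      rw [finiteSplitProb, ← hz]
      ring
    rw [h]
    exact hsum.hasSum.mul_left z
  -- The quadratic equation for z c has the roots p and 1 - p; this bound excludes p > 1/2.
  have hhalf : z * c ≤ 1 / 2 := by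
    refine le_of_tendsto' hS.tendsto_sum_nat fun n => le_trans ?_ (limitCdf_le_half n)
    refine Finset.sum_le_sum fun l _ => ?_
    unfold finiteSplitProb
    rw [← hz]
    gcongr
  have hquad : (z * c - p) * (z * c - (1 - p)) = 0 := by
    have : z * c = z + z * c * (z * c) := by linear_combination z * hrec
    have h2 : p * (1 - p) = z := hz.symm
    linear_combination -this + h2
  rcases mul_eq_zero.1 hquad with h | h
  · linarith
  · rwa [sub_eq_zero.1 h] at hS

theorem tsum_ofReal_finiteSplitProb (hp : 1 / 2 < p) (hp1 : p < 1) :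
    ∑' l : ℕ, ENNReal.ofReal (finiteSplitProb p l) = ENNReal.ofReal (1 - p) := by
  have h := hasSum_finiteSplitProb hp hp1
  rw [← h.tsum_eq, ENNReal.ofReal_tsum_of_nonneg
    (fun l => finiteSplitProb_nonneg (by linarith) hp1.le l) h.summable]

end split

/-! ### The coupled splits and their monotonicity -/

/-- The size of the left subtree of a uniform binary tree with `n + 1` nodes, as a quantile function
of a uniform random variable. -/
def leftSize (n : ℕ) (u : ℝ) : ℕ := sInf {l | n ≤ l ∨ u < splitCdf n (l + 1)}

open Classical in
/-- The size of the left subtree of the infinite binary tree with parameter `p`, as a function of a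
uniform random variable. -/
def topSize (p u : ℝ) : ℕ∞ :=
  -- The left endpoint does not depend on p; only the length does. This yields monotonicity in p.
  if h : ∃ l : ℕ, u ∈ Set.Ico (limitCdf l) (limitCdf l + finiteSplitProb p l) then
    (h.choose : ℕ∞) else ⊤

/-- The sizes of the left and right subtrees of the random binary tree of positive size `s`, where
`⊤` is the size of the infinite tree with parameter `p`. -/
def split (p : ℝ) : ℕ∞ → ℝ → ℕ∞ × ℕ∞
  | ⊤, u => (topSize p u, topSize p (1 - u))
  -- The root uses one of the n nodes. The value at n = 0 is a default: `randomTree` never splits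
  -- size 0.
  | (n : ℕ), u => ((leftSize (n - 1) u : ℕ), (n - 1 - leftSize (n - 1) u : ℕ))

section leftSize

variable {n m : ℕ} {u : ℝ}

/-- The clause `n ≤ l` in `leftSize` keeps the set of the infimum nonempty and caps the value at n
for every real u. -/
theorem leftSize_le_iff : leftSize n u ≤ m ↔ n ≤ m ∨ u < splitCdf n (m + 1) := by
  constructor
  · intro h
    have hmem : leftSize n u ∈ {l | n ≤ l ∨ u < splitCdf n (l + 1)} :=
      Nat.sInf_mem ⟨n, Or.inl le_rfl⟩
    rcases hmem with h' | h'
    · exact Or.inl (h'.trans h)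
    · exact Or.inr (h'.trans_le (splitCdf_mono n (by omega)))
  · exact fun h => Nat.sInf_le h

theorem leftSize_le : leftSize n u ≤ n := leftSize_le_iff.2 (Or.inl le_rfl)

theorem leftSize_le_succ (n : ℕ) (u : ℝ) : leftSize n u ≤ leftSize (n + 1) u := by
  rw [leftSize_le_iff]
  rcases leftSize_le_iff.1 (le_refl (leftSize (n + 1) u)) with h | h
  · left; omega
  · rcases le_or_gt n (leftSize (n + 1) u) with h' | h'
    · exact Or.inl h'
    · exact Or.inr (h.trans_le (splitCdf_succ_le (by omega)))

/-- An extra node raises the left size by at most one, so the right size cannot drop. -/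
theorem leftSize_succ_le (n : ℕ) (u : ℝ) : leftSize (n + 1) u ≤ leftSize n u + 1 := by
  rw [leftSize_le_iff]
  rcases leftSize_le_iff.1 (le_refl (leftSize n u)) with h | h
  · left; omega
  · have := leftSize_le (n := n) (u := u)
    exact Or.inr (h.trans_le (splitCdf_le_succ_succ (by omega)))

theorem leftSize_mono (u : ℝ) : Monotone fun n => leftSize n u :=
  monotone_nat_of_le_succ fun n => leftSize_le_succ n u

theorem sub_leftSize_mono (u : ℝ) : Monotone fun n => n - leftSize n u :=
  monotone_nat_of_le_succ fun n => by
    have := leftSize_succ_le n u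
    have := leftSize_le (n := n) (u := u)
    omega

theorem measurable_leftSize (n : ℕ) : Measurable (leftSize n) := by
  refine measurable_of_Iic fun m => ?_
  have : leftSize n ⁻¹' Set.Iic m = {u | n ≤ m ∨ u < splitCdf n (m + 1)} := by
    ext u
    simp [leftSize_le_iff]
  rw [this, measurableSet_setOfPred]
  exact measurable_const.or (measurableSet_setOfPred.1 measurableSet_Iio)

end leftSize

section topSize

variable {p q u : ℝ}

theorem topSize_eq_coe_iff (hp0 : 0 ≤ p) (hp1 : p ≤ 1) (l : ℕ) :
    topSize p u = l ↔ u ∈ Set.Ico (limitCdf l) (limitCdf l + finiteSplitProb p l) := by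
  have hle {i j : ℕ} (hi : limitCdf i ≤ u) (hj : u < limitCdf j + finiteSplitProb p j) :
      i ≤ j := by
    by_contra! hlt
    have h1 := limitCdf_add_finiteSplitProb_le hp0 hp1 j
    have h2 := limitCdf_mono (Nat.succ_le_of_lt hlt)
    simp only [Nat.succ_eq_add_one] at h2
    linarith
  unfold topSize
  split_ifs with h
  · have hc := h.choose_spec
    rw [Nat.cast_inj]
    constructor
    · intro h'
      rwa [h'] at hc
    · intro h'
      exact le_antisymm (hle hc.1 h'.2) (hle h'.1 hc.2)
  · simp only [ENat.top_ne_natCast, false_iff]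
    exact fun h' => h ⟨l, h'⟩

theorem topSize_mono (hp : 1 / 2 ≤ p) (hpq : p ≤ q) (hq : q ≤ 1) : topSize p u ≤ topSize q u := by
  induction h : topSize q u using ENat.recTopCoe with
  | top => exact le_top
  | coe l =>
    rw [topSize_eq_coe_iff (by linarith) hq] at h
    refine ((topSize_eq_coe_iff (by linarith) (by linarith) l).2 ⟨h.1, h.2.trans_le ?_⟩).le
    linarith [finiteSplitProb_anti hp hpq hq l]

theorem lt_limitCdf_of_topSize_eq (hp0 : 0 ≤ p) (hp1 : p ≤ 1) {l : ℕ} (h : topSize p u = l) :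
    u < limitCdf (l + 1) :=
  ((topSize_eq_coe_iff hp0 hp1 l).1 h).2.trans_le (limitCdf_add_finiteSplitProb_le hp0 hp1 l)

/-- A finite size forces its label below 1/2, which cannot hold for both u and 1 - u. -/
theorem topSize_eq_top_or (hp0 : 0 ≤ p) (hp1 : p ≤ 1) :
    topSize p u = ⊤ ∨ topSize p (1 - u) = ⊤ := by
  by_contra! h
  obtain ⟨l, hl⟩ := ENat.ne_top_iff_exists.1 h.1
  obtain ⟨r, hr⟩ := ENat.ne_top_iff_exists.1 h.2
  have h1 := lt_limitCdf_of_topSize_eq hp0 hp1 hl.symm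
  have h2 := lt_limitCdf_of_topSize_eq hp0 hp1 hr.symm
  linarith [limitCdf_le_half (l + 1), limitCdf_le_half (r + 1)]

theorem leftSize_le_topSize (hp0 : 0 ≤ p) (hp1 : p ≤ 1) (n : ℕ) :
    (leftSize n u : ℕ∞) ≤ topSize p u := by
  induction h : topSize p u using ENat.recTopCoe with
  | top => exact le_top
  | coe l =>
    rw [Nat.cast_le, leftSize_le_iff]
    rcases le_or_gt n l with hl | hl
    · exact Or.inl hl
    · exact Or.inr ((lt_limitCdf_of_topSize_eq hp0 hp1 h).trans_le
        (limitCdf_le_splitCdf (by omega)))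

theorem sub_leftSize_le_topSize (hp0 : 0 ≤ p) (hp1 : p ≤ 1) (n : ℕ) :
    ((n - leftSize n u : ℕ) : ℕ∞) ≤ topSize p (1 - u) := by
  induction h : topSize p (1 - u) using ENat.recTopCoe with
  | top => exact le_top
  | coe l =>
    rw [Nat.cast_le]
    rcases le_or_gt n l with hl | hl
    · omega
    · have h1 := lt_limitCdf_of_topSize_eq hp0 hp1 h
      have h2 : limitCdf (l + 1) ≤ splitCdf n (l + 1) := limitCdf_le_splitCdf (by omega)
      have h3 := splitCdf_add_splitCdf (n := n) (j := l + 1) (by omega)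
      -- By symmetry, 1 - u < `splitCdf n (l + 1)` says that u exceeds the distribution function at
      -- n - l, so at least n - l nodes go left.
      have h4 : ¬ leftSize n u ≤ n - l - 1 := by
        rw [leftSize_le_iff, not_or, show n - l - 1 + 1 = n + 1 - (l + 1) by omega]
        exact ⟨by omega, by linarith⟩
      omega

theorem measurable_topSize (hp0 : 0 ≤ p) (hp1 : p ≤ 1) : Measurable (topSize p) := by
  have hcoe (l : ℕ) : MeasurableSet (topSize p ⁻¹' {(l : ℕ∞)}) := by
    have : topSize p ⁻¹' {(l : ℕ∞)} = Set.Ico (limitCdf l) (limitCdf l + finiteSplitProb p l) := by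
      ext u
      exact topSize_eq_coe_iff hp0 hp1 l
    rw [this]
    exact measurableSet_Ico
  refine measurable_to_countable' fun s => ?_
  induction s using ENat.recTopCoe with
  | coe l => exact hcoe l
  | top =>
    have : topSize p ⁻¹' {⊤} = (⋃ l : ℕ, topSize p ⁻¹' {(l : ℕ∞)})ᶜ := by
      ext u
      simp only [Set.mem_preimage, Set.mem_singleton_iff, Set.mem_compl_iff, Set.mem_iUnion]
      rw [← not_iff_not, not_not, ← ne_eq, ENat.ne_top_iff_exists]
      simp only [eq_comm]
    rw [this]
    exact (MeasurableSet.iUnion hcoe).compl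

end topSize

section split

variable {p q : ℝ}

@[simp] theorem split_top (p u : ℝ) : split p ⊤ u = (topSize p u, topSize p (1 - u)) := rfl

theorem split_succ (p : ℝ) (n : ℕ) (u : ℝ) :
    split p (n + 1 : ℕ) u = ((leftSize n u : ℕ∞), ((n - leftSize n u : ℕ) : ℕ∞)) := rfl

/-- The heart of the coupling: one label, used for all sizes and parameters, orders both subtree
sizes at once. -/
theorem split_mono (hp : 1 / 2 ≤ p) (hpq : p ≤ q) (hq : q ≤ 1) {s s' : ℕ∞} (hs : s ≠ 0)
    (hss' : s ≤ s') (u : ℝ) : split p s u ≤ split q s' u := by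
  induction s' using ENat.recTopCoe with
  | top =>
    induction s using ENat.recTopCoe with
    | top => exact ⟨topSize_mono hp hpq hq, topSize_mono hp hpq hq⟩
    | coe n =>
      exact ⟨leftSize_le_topSize (by linarith) hq _, sub_leftSize_le_topSize (by linarith) hq _⟩
  | coe m =>
    induction s using ENat.recTopCoe with
    | top => exact absurd hss' (by simp)
    | coe n =>
      have hnm : n - 1 ≤ m - 1 := Nat.sub_le_sub_right (Nat.cast_le.1 hss') 1
      exact ⟨Nat.cast_le.2 (leftSize_mono u hnm), Nat.cast_le.2 (sub_leftSize_mono u hnm)⟩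

theorem measurable_split (hp0 : 0 ≤ p) (hp1 : p ≤ 1) (s : ℕ∞) : Measurable (split p s) := by
  induction s using ENat.recTopCoe with
  | top =>
    exact (measurable_topSize hp0 hp1).prodMk
      ((measurable_topSize hp0 hp1).comp (measurable_const.sub measurable_id))
  | coe n =>
    have h : Measurable fun k : ℕ => ((k : ℕ∞), ((n - 1 - k : ℕ) : ℕ∞)) := .of_discrete
    exact h.comp (measurable_leftSize (n - 1))

end split

/-! ### Laws of the splits under a uniform label -/

/-- The uniform distribution on `[0, 1]`. -/
def unif : Measure ℝ := volume.restrict (Set.Icc 0 1)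

section unif

instance : IsProbabilityMeasure unif := ⟨by simp [unif]⟩

theorem unif_Ico {a b : ℝ} (ha : 0 ≤ a) (hb : b ≤ 1) :
    unif (Set.Ico a b) = ENNReal.ofReal (b - a) := by
  rw [unif, Measure.restrict_apply measurableSet_Ico, Set.inter_eq_left.2, Real.volume_Ico]
  exact fun x hx => ⟨ha.trans hx.1, hx.2.le.trans hb⟩

theorem unif_Ioc {a b : ℝ} (ha : 0 ≤ a) (hb : b ≤ 1) :
    unif (Set.Ioc a b) = ENNReal.ofReal (b - a) := by
  rw [unif, Measure.restrict_apply measurableSet_Ioc, Set.inter_eq_left.2, Real.volume_Ioc]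
  exact fun x hx => ⟨ha.trans hx.1.le, hx.2.trans hb⟩

theorem unif_Iio {b : ℝ} (hb : b ≤ 1) : unif (Set.Iio b) = ENNReal.ofReal b := by
  have : Set.Iio b ∩ Set.Icc 0 1 = Set.Ico 0 b := by
    ext x
    simp only [Set.mem_inter_iff, Set.mem_Iio, Set.mem_Icc, Set.mem_Ico]
    exact ⟨fun h => ⟨h.2.1, h.1⟩, fun h => ⟨h.2, h.1, h.2.le.trans hb⟩⟩
  rw [unif, Measure.restrict_apply measurableSet_Iio, this, Real.volume_Ico, sub_zero]

theorem unif_leftSize_le {n m : ℕ} (hm : m ≤ n) :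
    unif {u | leftSize n u ≤ m} = ENNReal.ofReal (splitCdf n (m + 1)) := by
  rcases hm.eq_or_lt with rfl | hlt
  · simp [leftSize_le, splitCdf_self]
  · have : {u | leftSize n u ≤ m} = Set.Iio (splitCdf n (m + 1)) := by
      ext u
      simp [leftSize_le_iff, hlt]
    rw [this, unif_Iio (splitCdf_le_one (by omega))]

theorem unif_leftSize_eq {n l : ℕ} (hl : l ≤ n) :
    unif {u | leftSize n u = l} = ENNReal.ofReal (splitProb n l) := by
  cases l with
  | zero =>
    have := unif_leftSize_le (Nat.zero_le n)
    simpa [splitCdf] using this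
  | succ l =>
    have h1 := unif_leftSize_le hl
    have h2 := unif_leftSize_le (show l ≤ n by omega)
    have h : {u | leftSize n u ≤ l + 1} = {u | leftSize n u ≤ l} ∪ {u | leftSize n u = l + 1} := by
      ext u
      simp only [Set.mem_ofPred_eq, Set.mem_union]
      omega
    rw [h, measure_union, h2, splitCdf_succ n (l + 1),
      ENNReal.ofReal_add (splitCdf_nonneg _ _) (splitProb_nonneg _ _)] at h1
    · exact (ENNReal.add_right_inj ENNReal.ofReal_ne_top).1 h1
    · rw [Set.disjoint_left]
      intro u hu hu'
      simp only [Set.mem_ofPred_eq] at hu hu'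
      omega
    · exact measurable_leftSize n (measurableSet_singleton _)

theorem unif_topSize_eq {p : ℝ} (hp0 : 0 ≤ p) (hp1 : p ≤ 1) (l : ℕ) :
    unif {u | topSize p u = l} = ENNReal.ofReal (finiteSplitProb p l) := by
  have : {u | topSize p u = l} = Set.Ico (limitCdf l) (limitCdf l + finiteSplitProb p l) := by
    ext u
    exact topSize_eq_coe_iff hp0 hp1 l
  rw [this, unif_Ico (limitCdf_nonneg l), add_sub_cancel_left]
  linarith [limitCdf_add_finiteSplitProb_le hp0 hp1 l, limitCdf_le_half (l + 1)]

theorem unif_topSize_one_sub_eq {p : ℝ} (hp0 : 0 ≤ p) (hp1 : p ≤ 1) (l : ℕ) :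
    unif {u | topSize p (1 - u) = l} = ENNReal.ofReal (finiteSplitProb p l) := by
  have : {u | topSize p (1 - u) = l} =
      Set.Ioc (1 - (limitCdf l + finiteSplitProb p l)) (1 - limitCdf l) := by
    ext u
    simp only [Set.mem_ofPred_eq, topSize_eq_coe_iff hp0 hp1, Set.mem_Ico, Set.mem_Ioc]
    constructor <;> rintro ⟨h1, h2⟩ <;> constructor <;> linarith
  have h1 := limitCdf_add_finiteSplitProb_le hp0 hp1 l
  rw [this, unif_Ioc]
  · congr 1
    ring
  · linarith [limitCdf_le_half (l + 1)]
  · linarith [limitCdf_nonneg l]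

theorem lintegral_split_top {p : ℝ} (hp : 1 / 2 < p) (hp1 : p < 1) (f : ℕ∞ × ℕ∞ → ℝ≥0∞) :
    ∫⁻ u, f (split p ⊤ u) ∂unif =
      ∑' l : ℕ, ENNReal.ofReal (finiteSplitProb p l) * f (l, ⊤) +
      ∑' l : ℕ, ENNReal.ofReal (finiteSplitProb p l) * f (⊤, l) +
      ENNReal.ofReal (2 * p - 1) * f (⊤, ⊤) := by
  have hp0 : 0 ≤ p := by linarith
  let A : ℕ → Set ℝ := fun l => {u | topSize p u = l}
  let B : ℕ → Set ℝ := fun l => {u | topSize p (1 - u) = l}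
  let C : Set ℝ := split p ⊤ ⁻¹' {(⊤, ⊤)}
  have hA (l : ℕ) : MeasurableSet (A l) :=
    measurable_topSize hp0 hp1.le (measurableSet_singleton _)
  have hB (l : ℕ) : MeasurableSet (B l) :=
    ((measurable_topSize hp0 hp1.le).comp (measurable_const.sub measurable_id))
      (measurableSet_singleton _)
  have hC : MeasurableSet C := measurable_split hp0 hp1.le ⊤ (measurableSet_singleton _)
  -- At most one of the two sizes is finite, so exactly one of the indicators is nonzero.
  have hpt (g : ℕ∞ × ℕ∞ → ℝ≥0∞) (u : ℝ) : g (split p ⊤ u) =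
      ∑' l : ℕ, (A l).indicator (fun _ => g (l, ⊤)) u +
      ∑' l : ℕ, (B l).indicator (fun _ => g (⊤, l)) u + C.indicator (fun _ => g (⊤, ⊤)) u := by
    have hor := topSize_eq_top_or (u := u) hp0 hp1.le
    induction h1 : topSize p u using ENat.recTopCoe with
    | top =>
      induction h2 : topSize p (1 - u) using ENat.recTopCoe with
      | top => simp [A, B, C, Set.indicator, h1, h2]
      | coe r => simp [A, B, C, Set.indicator, h1, h2, Nat.cast_inj]
    | coe l =>
      have h2 : topSize p (1 - u) = ⊤ := hor.resolve_left (by simp [h1])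
      simp [A, B, C, Set.indicator, h1, h2, Nat.cast_inj]
  have hint (g : ℕ∞ × ℕ∞ → ℝ≥0∞) : ∫⁻ u, g (split p ⊤ u) ∂unif =
      ∑' l : ℕ, ENNReal.ofReal (finiteSplitProb p l) * g (l, ⊤) +
      ∑' l : ℕ, ENNReal.ofReal (finiteSplitProb p l) * g (⊤, l) + unif C * g (⊤, ⊤) := by
    simp only [hpt g]
    rw [lintegral_add_right _ (measurable_const.indicator hC),
      lintegral_add_right _ (Measurable.tsum fun l => measurable_const.indicator (hB l)),
      lintegral_tsum fun l => (measurable_const.indicator (hA l)).aemeasurable,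
      lintegral_tsum fun l => (measurable_const.indicator (hB l)).aemeasurable,
      lintegral_indicator_const hC]
    simp only [lintegral_indicator_const (hA _), lintegral_indicator_const (hB _)]
    simp only [A, B, unif_topSize_eq hp0 hp1.le, unif_topSize_one_sub_eq hp0 hp1.le,
      mul_comm]
  -- The total mass is 1 and each one-sided finite case has mass 1 - p, which leaves 2p - 1.
  have hCval : unif C = ENNReal.ofReal (2 * p - 1) := by
    have h := hint fun _ => 1
    simp only [lintegral_const, measure_univ, mul_one, tsum_ofReal_finiteSplitProb hp hp1] at h
    rw [← ENNReal.ofReal_add (by linarith) (by linarith)] at h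
    have h' : (1 : ℝ≥0∞) = ENNReal.ofReal (1 - p + (1 - p)) + ENNReal.ofReal (2 * p - 1) := by
      rw [← ENNReal.ofReal_add (by linarith) (by linarith), ← ENNReal.ofReal_one]
      congr 1
      ring
    exact (ENNReal.add_right_inj ENNReal.ofReal_ne_top).1 (h.symm.trans h')
  rw [hint f, hCval]

end unif

/-! ### Self-similarity of the label field -/

/-- The law of independent uniform random variables at the nodes of the infinite binary tree, which
are coded as words. -/
def uniformField : Measure (List Bool → ℝ) := Measure.infinitePi fun _ => unif

instance : IsProbabilityMeasure uniformField :=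
  inferInstanceAs (IsProbabilityMeasure (Measure.infinitePi fun _ => unif))

/-- The labelling of the binary tree with label `u` at the root, and the labellings `a` and `b` of
the left and right subtrees. -/
def joinField (u : ℝ) (a b : List Bool → ℝ) : List Bool → ℝ
  | [] => u
  | false :: w => a w
  | true :: w => b w

section uniformField

theorem measurable_joinField :
    Measurable fun x : ℝ × (List Bool → ℝ) × (List Bool → ℝ) => joinField x.1 x.2.1 x.2.2 := by
  refine measurable_pi_iff.2 fun w => ?_
  match w with
  | [] => exact measurable_fst
  | false :: w => exact (measurable_pi_apply w).comp (measurable_fst.comp measurable_snd)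
  | true :: w => exact (measurable_pi_apply w).comp (measurable_snd.comp measurable_snd)

theorem map_joinField : (unif.prod (uniformField.prod uniformField)).map
    (fun x => joinField x.1 x.2.1 x.2.2) = uniformField := by
  classical
  refine Measure.eq_infinitePi _ fun s t ht => ?_
  have hF : Function.Injective (List.cons false) := List.cons_injective
  have hT : Function.Injective (List.cons true) := List.cons_injective
  let r : Set ℝ := if [] ∈ s then t [] else Set.univ
  have hpre : (fun x : ℝ × (List Bool → ℝ) × (List Bool → ℝ) => joinField x.1 x.2.1 x.2.2) ⁻¹'
      Set.pi s t = r ×ˢ (Set.pi (s.preimage _ hF.injOn) fun w => t (false :: w)) ×ˢ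
        (Set.pi (s.preimage _ hT.injOn) fun w => t (true :: w)) := by
    ext ⟨u, a, b⟩
    simp only [Set.mem_preimage, Set.mem_pi, Set.mem_prod, Finset.mem_coe, Finset.mem_preimage, r]
    constructor
    · intro h
      refine ⟨?_, fun w hw => h _ hw, fun w hw => h _ hw⟩
      split_ifs with h0
      · exact h _ h0
      · trivial
    · rintro ⟨h0, hf, ht⟩ w hw
      match w with
      | [] =>
        rw [if_pos hw] at h0
        exact h0
      | false :: w => exact hf w hw
      | true :: w => exact ht w hw
  -- The product over `s` is grouped by first letter; `none` stands for the root.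
  have hr : unif r = ∏ w ∈ s with w.head? = none, unif (t w) := by
    simp only [List.head?_eq_none_iff, Finset.filter_eq' s]
    by_cases h : [] ∈ s
    · simp [r, h]
    · simp [r, h]
  have hb (b : Bool) : ∏ w ∈ s.preimage _ (List.cons_injective (a := b)).injOn, unif (t (b :: w)) =
      ∏ w ∈ s with w.head? = some b, unif (t w) := by
    rw [Finset.prod_preimage' (List.cons b) s _ fun w => unif (t w)]
    refine Finset.prod_congr (Finset.filter_congr fun w _ => ?_) fun _ _ => rfl
    cases w <;> simp [eq_comm]
  rw [Measure.map_apply measurable_joinField (.pi s.countable_toSet fun w _ => ht w), hpre,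
    Measure.prod_prod, Measure.prod_prod, uniformField, Measure.infinitePi_pi _ fun w _ => ht _,
    Measure.infinitePi_pi _ fun w _ => ht _, hr, hb, hb,
    ← Finset.prod_fiberwise s List.head?, Fintype.prod_option, Fintype.prod_bool]
  ring

theorem uniformField_apply {S : Set (List Bool → ℝ)} (hS : MeasurableSet S) :
    uniformField S =
      ∫⁻ u, (uniformField.prod uniformField) {x | joinField u x.1 x.2 ∈ S} ∂unif := by
  conv_lhs => rw [← map_joinField]
  rw [Measure.map_apply measurable_joinField hS, Measure.prod_apply (measurable_joinField hS)]
  rfl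

end uniformField

/-! ### The random trees, their monotonicity, and uniformity at finite size -/

/-- Membership of a vertex in the random plane tree that corresponds to the random binary tree of
size `s`, built from the labels `ω`. -/
def MemRandomTree (p : ℝ) (s : ℕ∞) (ω : List Bool → ℝ) (v : Vertex) : Prop :=
  match v with
  | [] => True
  | 0 :: w => s ≠ 0 ∧ MemRandomTree p (split p s (ω [])).1 (fun x => ω (false :: x)) w
  | (i + 1) :: w =>
    s ≠ 0 ∧ MemRandomTree p (split p s (ω [])).2 (fun x => ω (true :: x)) (i :: w)
-- The recursion is on the vertex, since a size equal to `⊤` need not decrease.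
termination_by v.sum + v.length

/-- The random plane tree that corresponds to the random binary tree of size `s`, built from the
labels `ω`. -/
def randomTree (p : ℝ) (s : ℕ∞) (ω : List Bool → ℝ) : VertexSet := {v | MemRandomTree p s ω v}

section randomTree

variable {p q : ℝ} {s s' : ℕ∞} {ω : List Bool → ℝ}

theorem nil_mem_randomTree : [] ∈ randomTree p s ω := by
  simp [randomTree, MemRandomTree]

theorem randomTree_zero (p : ℝ) (ω : List Bool → ℝ) : randomTree p 0 ω = {[]} := by
  ext v
  match v with
  | [] => simp [nil_mem_randomTree]
  | 0 :: w => simp [randomTree, MemRandomTree]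
  | (i + 1) :: w => simp [randomTree, MemRandomTree]

theorem randomTree_of_ne_zero (hs : s ≠ 0) : randomTree p s ω =
    nodeSet (randomTree p (split p s (ω [])).1 fun x => ω (false :: x))
      (randomTree p (split p s (ω [])).2 fun x => ω (true :: x)) := by
  ext v
  match v with
  | [] => simp [nil_mem_randomTree]
  | 0 :: w =>
    rw [zero_cons_mem_nodeSet]
    simp only [randomTree, Set.mem_ofPred_eq]
    rw [MemRandomTree]
    simp [hs]
  | (i + 1) :: w =>
    rw [succ_cons_mem_nodeSet]
    simp only [randomTree, Set.mem_ofPred_eq]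
    rw [MemRandomTree]
    simp [hs]

theorem randomTree_joinField (hs : s ≠ 0) (u : ℝ) (a b : List Bool → ℝ) :
    randomTree p s (joinField u a b) =
      nodeSet (randomTree p (split p s u).1 a) (randomTree p (split p s u).2 b) :=
  randomTree_of_ne_zero hs

/-- Following the path to the vertex in the binary encoding, `split_mono` keeps the sizes ordered at
each step. -/
theorem mem_randomTree_of_mem (hp : 1 / 2 ≤ p) (hpq : p ≤ q) (hq : q ≤ 1) (v : Vertex)
    {s s' : ℕ∞} (hss' : s ≤ s') {ω : List Bool → ℝ} :
    v ∈ randomTree p s ω → v ∈ randomTree q s' ω := by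
  by_cases hs : s = 0
  · rw [hs, randomTree_zero]
    intro hv
    rw [Set.mem_singleton_iff.1 hv]
    exact nil_mem_randomTree
  · have hs' : s' ≠ 0 := fun h => hs (by simpa [h] using hss')
    have hsplit := split_mono hp hpq hq hs hss' (ω [])
    rw [randomTree_of_ne_zero hs, randomTree_of_ne_zero hs']
    match v with
    | [] => exact fun _ => trivial
    | 0 :: w => exact mem_randomTree_of_mem hp hpq hq w hsplit.1
    | (i + 1) :: w => exact mem_randomTree_of_mem hp hpq hq (i :: w) hsplit.2
termination_by v.sum + v.length

/-- The random trees increase with their size and with the parameter of the infinite trees. -/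
theorem randomTree_mono (hp : 1 / 2 ≤ p) (hpq : p ≤ q) (hq : q ≤ 1) {s s' : ℕ∞} (hss' : s ≤ s')
    (ω : List Bool → ℝ) : randomTree p s ω ⊆ randomTree q s' ω :=
  fun v hv => mem_randomTree_of_mem hp hpq hq v hss' hv

theorem mem_randomTree_of_append_mem (v : Vertex) (i : ℕ) {s : ℕ∞} {ω : List Bool → ℝ} :
    v ++ [i] ∈ randomTree p s ω → v ∈ randomTree p s ω := by
  by_cases hs : s = 0
  · simp [hs, randomTree_zero]
  · rw [randomTree_of_ne_zero hs]
    match v with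
    | [] => exact fun _ => trivial
    | 0 :: w => exact mem_randomTree_of_append_mem w i
    | (j + 1) :: w => exact mem_randomTree_of_append_mem (j :: w) i
termination_by v.sum + v.length

theorem append_mem_randomTree_of_succ (v : Vertex) (i : ℕ) {s : ℕ∞} {ω : List Bool → ℝ} :
    v ++ [i + 1] ∈ randomTree p s ω → v ++ [i] ∈ randomTree p s ω := by
  by_cases hs : s = 0
  · simp [hs, randomTree_zero]
  · rw [randomTree_of_ne_zero hs]
    match v, i with
    | [], 0 => exact fun _ => nil_mem_randomTree
    | [], j + 1 => exact append_mem_randomTree_of_succ [] j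
    | 0 :: w, i => exact append_mem_randomTree_of_succ w i
    | (j + 1) :: w, i => exact append_mem_randomTree_of_succ (j :: w) i
termination_by v.sum + v.length + i

theorem isPlaneTree_randomTree (p : ℝ) (s : ℕ∞) (ω : List Bool → ℝ) :
    IsPlaneTree (randomTree p s ω) where
  root_mem := nil_mem_randomTree
  parent_mem v i := mem_randomTree_of_append_mem v i
  sibling_mem v i := append_mem_randomTree_of_succ v i

theorem exists_toSet_eq_randomTree (p : ℝ) (n : ℕ) (ω : List Bool → ℝ) :
    ∃ t : BinaryTree Unit, t.numNodes = n ∧ toSet t = randomTree p n ω := by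
  induction n using Nat.strong_induction_on generalizing ω with
  | _ n ih =>
    cases n with
    | zero => exact ⟨.nil, rfl, (randomTree_zero p ω).symm⟩
    | succ n =>
      have hle : leftSize n (ω []) ≤ n := leftSize_le
      obtain ⟨a, ha, ha'⟩ := ih (leftSize n (ω [])) (by omega) fun x => ω (false :: x)
      obtain ⟨b, hb, hb'⟩ := ih (n - leftSize n (ω [])) (by omega) fun x => ω (true :: x)
      refine ⟨.node () a b, by rw [BinaryTree.numNodes, ha, hb]; omega, ?_⟩
      rw [randomTree_of_ne_zero (by simp), split_succ, toSet, ha', hb']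

theorem numNodes_eq_of_randomTree_eq {n : ℕ} {t : BinaryTree Unit}
    (h : randomTree p n ω = toSet t) : t.numNodes = n := by
  obtain ⟨t', ht', h'⟩ := exists_toSet_eq_randomTree p n ω
  rw [← ht', toSet_injective (h'.trans h)]

theorem measurable_mem_randomTree (hp0 : 0 ≤ p) (hp1 : p ≤ 1) (v : Vertex) (s : ℕ∞) :
    Measurable fun ω => v ∈ randomTree p s ω := by
  by_cases hs : s = 0
  · simp [hs, randomTree_zero]
  · simp only [randomTree_of_ne_zero hs]
    have hsplit : Measurable fun ω : List Bool → ℝ => split p s (ω []) :=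
      (measurable_split hp0 hp1 s).comp (measurable_pi_apply [])
    have hb (b : Bool) : Measurable fun (ω : List Bool → ℝ) x => ω (b :: x) :=
      measurable_pi_iff.2 fun x => measurable_pi_apply _
    match v with
    | [] => simp
    | 0 :: w =>
      -- The size of the subtree is random but has countably many values, so it can be fixed before
      -- recursing.
      have : (fun ω : List Bool → ℝ =>
            w ∈ randomTree p (split p s (ω [])).1 fun x => ω (false :: x))
          = fun ω => ∃ r : ℕ∞, (split p s (ω [])).1 = r ∧
            w ∈ randomTree p r fun x => ω (false :: x) := by
        ext ω
        simp
      simp only [zero_cons_mem_nodeSet]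
      rw [this]
      exact .exists fun r => ((measurable_fst.comp hsplit).eq_const r).and
        ((measurable_mem_randomTree hp0 hp1 w r).comp (hb false))
    | (i + 1) :: w =>
      have : (fun ω : List Bool → ℝ =>
            i :: w ∈ randomTree p (split p s (ω [])).2 fun x => ω (true :: x))
          = fun ω => ∃ r : ℕ∞, (split p s (ω [])).2 = r ∧
            i :: w ∈ randomTree p r fun x => ω (true :: x) := by
        ext ω
        simp
      simp only [succ_cons_mem_nodeSet]
      rw [this]
      exact .exists fun r => ((measurable_snd.comp hsplit).eq_const r).and
        ((measurable_mem_randomTree hp0 hp1 (i :: w) r).comp (hb true))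
termination_by v.sum + v.length

theorem measurable_randomTree (hp0 : 0 ≤ p) (hp1 : p ≤ 1) (s : ℕ∞) :
    Measurable (randomTree p s) :=
  measurable_set_iff.2 fun v => measurable_mem_randomTree hp0 hp1 v s

theorem uniformField_toSet_node_subset (hp0 : 0 ≤ p) (hp1 : p ≤ 1) (hs : s ≠ 0)
    (a b : BinaryTree Unit) :
    uniformField {ω | toSet (.node () a b) ⊆ randomTree p s ω} =
      ∫⁻ u, uniformField {ω | toSet a ⊆ randomTree p (split p s u).1 ω} *
        uniformField {ω | toSet b ⊆ randomTree p (split p s u).2 ω} ∂unif := by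
  have hmeas : MeasurableSet {ω | toSet (.node () a b) ⊆ randomTree p s ω} :=
    measurable_randomTree hp0 hp1 s (measurableSet_toSet_subset _)
  rw [uniformField_apply hmeas]
  refine lintegral_congr fun u => ?_
  rw [← Measure.prod_prod]
  congr 1
  ext ⟨x, y⟩
  simp only [Set.mem_ofPred_eq, Set.mem_prod]
  rw [randomTree_joinField hs, toSet, nodeSet_subset_nodeSet nil_mem_randomTree]

theorem uniformField_randomTree_eq_toSet_node (hp0 : 0 ≤ p) (hp1 : p ≤ 1) (hs : s ≠ 0)
    (a b : BinaryTree Unit) :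
    uniformField {ω | randomTree p s ω = toSet (.node () a b)} =
      ∫⁻ u, uniformField {ω | randomTree p (split p s u).1 ω = toSet a} *
        uniformField {ω | randomTree p (split p s u).2 ω = toSet b} ∂unif := by
  have hmeas : MeasurableSet {ω | randomTree p s ω = toSet (.node () a b)} :=
    measurable_randomTree hp0 hp1 s (measurableSet_singleton _)
  rw [uniformField_apply hmeas]
  refine lintegral_congr fun u => ?_
  rw [← Measure.prod_prod]
  congr 1
  ext ⟨x, y⟩
  simp only [Set.mem_ofPred_eq, Set.mem_prod]
  rw [randomTree_joinField hs, toSet,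
    nodeSet_inj nil_mem_randomTree (isPlaneTree_toSet b).root_mem]

/-- The random tree of a finite size is uniformly distributed. -/
theorem uniformField_randomTree_eq (hp0 : 0 ≤ p) (hp1 : p ≤ 1) (t : BinaryTree Unit) :
    uniformField {ω | randomTree p t.numNodes ω = toSet t} = (catalan t.numNodes : ℝ≥0∞)⁻¹ := by
  induction t with
  | nil => simp [randomTree_zero, toSet, BinaryTree.numNodes]
  | node _ a b iha ihb =>
    set n := a.numNodes + b.numNodes with hn
    have hnodes : (BinaryTree.node () a b).numNodes = n + 1 := rfl
    -- Only a split with the right left size can produce the tree; given it, both subtrees are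
    -- uniform. The Catalan numbers of the subtrees then cancel against `splitProb`.
    have hpt (u : ℝ) :
        uniformField {ω | randomTree p (split p (n + 1 : ℕ) u).1 ω = toSet a} *
          uniformField {ω | randomTree p (split p (n + 1 : ℕ) u).2 ω = toSet b} =
        {u | leftSize n u = a.numNodes}.indicator
          (fun _ => (catalan a.numNodes : ℝ≥0∞)⁻¹ * (catalan b.numNodes : ℝ≥0∞)⁻¹) u := by
      rw [split_succ]
      by_cases h : leftSize n u = a.numNodes
      · have h' : n - a.numNodes = b.numNodes := by omega
        rw [Set.indicator_of_mem (by exact h)]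
        simp only [h, h']
        rw [iha, ihb]
      · rw [Set.indicator_of_notMem (by exact h)]
        have : {ω | randomTree p (leftSize n u) ω = toSet a} = ∅ := by
          ext ω
          simp only [Set.mem_ofPred_eq, Set.mem_empty_iff_false, iff_false]
          exact fun h' => h (numNodes_eq_of_randomTree_eq h').symm
        simp [this]
    rw [hnodes, uniformField_randomTree_eq_toSet_node hp0 hp1 (by simp)]
    have hmeas : MeasurableSet {u | leftSize n u = a.numNodes} :=
      measurable_leftSize n (measurableSet_singleton _)
    simp only [hpt]
    rw [lintegral_indicator_const hmeas,
      unif_leftSize_eq (by omega), splitProb, show n - a.numNodes = b.numNodes by omega]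
    have ha : (0 : ℝ) < catalan a.numNodes := by exact_mod_cast catalan_pos _
    have hb : (0 : ℝ) < catalan b.numNodes := by exact_mod_cast catalan_pos _
    have hc : (0 : ℝ) < catalan (n + 1) := by exact_mod_cast catalan_pos _
    simp only [← ENNReal.ofReal_natCast]
    rw [← ENNReal.ofReal_inv_of_pos ha, ← ENNReal.ofReal_inv_of_pos hb,
      ← ENNReal.ofReal_inv_of_pos hc, ← ENNReal.ofReal_mul (by positivity),
      ← ENNReal.ofReal_mul (by positivity)]
    congr 1
    field_simp

open Classical in
theorem uniformField_randomTree_mem (hp0 : 0 ≤ p) (hp1 : p ≤ 1) (n : ℕ) (A : Set VertexSet) :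
    uniformField {ω | randomTree p n ω ∈ A} =
      ((BinaryTree.treesOfNumNodesEq n).filter fun t => toSet t ∈ A).card *
        (catalan n : ℝ≥0∞)⁻¹ := by
  have h : {ω | randomTree p n ω ∈ A} =
      ⋃ t ∈ (BinaryTree.treesOfNumNodesEq n).filter fun t => toSet t ∈ A,
        {ω | randomTree p n ω = toSet t} := by
    ext ω
    obtain ⟨t, ht, h⟩ := exists_toSet_eq_randomTree p n ω
    simp only [Set.mem_ofPred_eq, Set.mem_iUnion, Finset.mem_filter,
      BinaryTree.mem_treesOfNumNodesEq, exists_prop]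
    constructor
    · exact fun hA => ⟨t, ⟨ht, h ▸ hA⟩, h.symm⟩
    · rintro ⟨t', ⟨-, hA⟩, h'⟩
      exact h' ▸ hA
  rw [h, measure_biUnion_finset]
  · rw [Finset.sum_congr rfl, Finset.sum_const, nsmul_eq_mul]
    intro t ht
    obtain ⟨ht, -⟩ := Finset.mem_filter.1 ht
    have := uniformField_randomTree_eq hp0 hp1 t
    rwa [BinaryTree.mem_treesOfNumNodesEq.1 ht] at this
  · intro t _ t' _ hne
    rw [Function.onFun, Set.disjoint_left]
    intro ω hω hω'
    exact hne (toSet_injective (hω.symm.trans hω'))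
  · exact fun t _ => measurable_randomTree hp0 hp1 n (measurableSet_singleton _)

theorem map_randomTree (hp0 : 0 ≤ p) (hp1 : p ≤ 1) (n : ℕ) :
    uniformField.map (randomTree p n) = uniformTreeLaw (n + 1) := by
  classical
  ext A hA
  have himage : (planeTreesOfSize (n + 1)) =
      ((BinaryTree.treesOfNumNodesEq n).image toSet : Finset VertexSet) := by
    rw [planeTreesOfSize_succ, Finset.coe_image]
  have hinter : planeTreesOfSize (n + 1) ∩ A =
      (((BinaryTree.treesOfNumNodesEq n).filter fun t => toSet t ∈ A).image toSet :
        Finset VertexSet) := by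
    rw [planeTreesOfSize_succ]
    ext T
    simp only [Set.mem_inter_iff, Set.mem_image, Finset.mem_coe, Finset.mem_image,
      Finset.mem_filter]
    constructor
    · rintro ⟨⟨t, ht, rfl⟩, hT⟩
      exact ⟨t, ⟨ht, hT⟩, rfl⟩
    · rintro ⟨t, ⟨ht, hT⟩, rfl⟩
      exact ⟨⟨t, ht, rfl⟩, hT⟩
  have hmeas : MeasurableSet (planeTreesOfSize (n + 1)) := by
    rw [himage]
    exact Finset.measurableSet _
  rw [Measure.map_apply (measurable_randomTree hp0 hp1 n) hA, uniformTreeLaw, uniformOn,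
    cond_apply hmeas, hinter, himage, Measure.count_apply_finset, Measure.count_apply_finset,
    Finset.card_image_of_injective _ toSet_injective,
    Finset.card_image_of_injective _ toSet_injective,
    BinaryTree.treesOfNumNodesEq_card_eq_catalan, mul_comm]
  exact uniformField_randomTree_mem hp0 hp1 n A

end randomTree

/-! ### The Galton–Watson tree conditioned to be infinite -/

section conditioned

variable {p : ℝ}

open Classical in
theorem galtonWatsonLaw_finite_eq_tsum (hp0 : 0 < p) (hp1 : p < 1) (t : BinaryTree Unit) :
    galtonWatsonLaw p {T | toSet t ⊆ T ∧ T.Finite} =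
      ∑' s : BinaryTree Unit, if toSet t ⊆ toSet s then
        ENNReal.ofReal p ^ s.numNodes * ENNReal.ofReal (1 - p) ^ (s.numNodes + 1) else 0 := by
  have hae : ({T : VertexSet | toSet t ⊆ T ∧ T.Finite} : Set VertexSet) =ᵐ[galtonWatsonLaw p]
      ⋃ s : BinaryTree Unit, if toSet t ⊆ toSet s then {toSet s} else ∅ := by
    filter_upwards [ae_isPlaneTree_galtonWatsonLaw p] with T hT
    refine propext ⟨fun h => ?_, fun h => ?_⟩
    · obtain ⟨s, rfl⟩ := hT.exists_toSet_eq h.2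
      exact Set.mem_iUnion.2 ⟨s, by rw [if_pos h.1]; rfl⟩
    · obtain ⟨s, hs⟩ := Set.mem_iUnion.1 h
      split_ifs at hs with h'
      · obtain rfl := Set.mem_singleton_iff.1 hs
        exact ⟨h', finite_toSet s⟩
      · exact hs.elim
  have hcount : Countable (BinaryTree Unit) :=
    Set.countable_univ_iff.1 (Set.MapsTo.countable_of_injOn (f := toSet)
      (t := {T : VertexSet | T.Finite}) (fun s _ => finite_toSet s) toSet_injective.injOn
      Set.Countable.ofPred_finite)
  rw [measure_congr hae, measure_iUnion]
  · refine tsum_congr fun s => ?_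
    split_ifs
    · exact galtonWatsonLaw_singleton hp0 hp1 s
    · exact measure_empty
  · intro s s' hne
    rw [Function.onFun]
    split_ifs
    · simpa using toSet_injective.ne hne
    all_goals simp
  · intro s
    split_ifs
    · exact measurableSet_singleton _
    · exact MeasurableSet.empty

/-- The mass of a finite tree factors as p times the masses of its two binary subtrees: a first
child exists with probability p, and the geometric law is memoryless. -/
theorem galtonWatsonLaw_finite_node (hp0 : 0 < p) (hp1 : p < 1) (a b : BinaryTree Unit) :
    galtonWatsonLaw p {T | toSet (.node () a b) ⊆ T ∧ T.Finite} =
      ENNReal.ofReal p * galtonWatsonLaw p {T | toSet a ⊆ T ∧ T.Finite} *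
        galtonWatsonLaw p {T | toSet b ⊆ T ∧ T.Finite} := by
  classical
  have hinj : Function.Injective
      fun x : BinaryTree Unit × BinaryTree Unit => BinaryTree.node () x.1 x.2 := by
    rintro ⟨x, y⟩ ⟨x', y'⟩ h
    simpa using h
  simp only [galtonWatsonLaw_finite_eq_tsum hp0 hp1]
  rw [← hinj.tsum_eq, ENNReal.tsum_prod', mul_assoc, ← ENNReal.tsum_mul_right,
    ← ENNReal.tsum_mul_left]
  · refine tsum_congr fun x => ?_
    rw [← ENNReal.tsum_mul_left, ← ENNReal.tsum_mul_left]
    refine tsum_congr fun y => ?_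
    simp only [toSet, nodeSet_subset_nodeSet (isPlaneTree_toSet y).root_mem, BinaryTree.numNodes]
    by_cases hx : toSet a ⊆ toSet x
    · by_cases hy : toSet b ⊆ toSet y
      · simp only [hx, hy, and_self, if_true]
        ring
      · simp [hy]
    · simp [hx]
  · intro s hs
    cases s with
    | nil =>
      refine absurd ?_ hs
      exact if_neg fun h =>
        absurd (h (isPlaneTree_toSet a).root_mem : [0] ∈ ({[]} : VertexSet)) (by simp)
    | node _ x y => exact ⟨(x, y), rfl⟩

/-- The finite Galton-Watson tree, with respect to its size. -/
theorem mul_galtonWatsonLaw_finite (hp0 : 0 < p) (hp1 : p < 1) (t : BinaryTree Unit) :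
    ENNReal.ofReal p * galtonWatsonLaw p {T | toSet t ⊆ T ∧ T.Finite} =
      ∑' n : ℕ, ENNReal.ofReal (finiteSplitProb p n) *
        uniformField {ω | toSet t ⊆ randomTree p n ω} := by
  classical
  -- Trees with n binary nodes all have the same mass, and p times their total mass is
  -- `finiteSplitProb p n`.
  rw [galtonWatsonLaw_finite_eq_tsum hp0 hp1, ← ENNReal.tsum_fiberwise _ BinaryTree.numNodes,
    ← ENNReal.tsum_mul_left]
  refine tsum_congr fun n => ?_
  have hfib : BinaryTree.numNodes ⁻¹' {n} =
      ((BinaryTree.treesOfNumNodesEq n : Finset (BinaryTree Unit)) : Set (BinaryTree Unit)) := by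
    ext s
    simp
  have hc : (catalan n : ℝ≥0∞) ≠ 0 := by exact_mod_cast (catalan_pos n).ne'
  have hunif := uniformField_randomTree_mem hp0.le hp1.le n {T | toSet t ⊆ T}
  simp only [Set.mem_ofPred_eq] at hunif
  rw [hunif, hfib, Finset.tsum_subtype' _ fun s => if toSet t ⊆ toSet s then
      ENNReal.ofReal p ^ s.numNodes * ENNReal.ofReal (1 - p) ^ (s.numNodes + 1) else 0,
    ← Finset.sum_filter,
    Finset.sum_congr rfl (g := fun _ => ENNReal.ofReal p ^ n * ENNReal.ofReal (1 - p) ^ (n + 1)),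
    Finset.sum_const, nsmul_eq_mul, finiteSplitProb, ENNReal.ofReal_mul (by positivity),
    ENNReal.ofReal_pow (mul_nonneg hp0.le (by linarith)), ENNReal.ofReal_mul hp0.le,
    ENNReal.ofReal_natCast]
  · calc _ = (ENNReal.ofReal p * ENNReal.ofReal (1 - p)) ^ (n + 1) *
          (Finset.card {s ∈ BinaryTree.treesOfNumNodesEq n | toSet t ⊆ toSet s} : ℝ≥0∞) * 1 := by
          ring
      _ = _ := by
          rw [← ENNReal.mul_inv_cancel hc (ENNReal.natCast_ne_top _)]
          ring
  · intro s hs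
    rw [BinaryTree.mem_treesOfNumNodesEq.1 (Finset.mem_filter.1 hs).1]

theorem galtonWatsonLaw_finite_add_infinite (p : ℝ) (t : BinaryTree Unit) :
    galtonWatsonLaw p {T | toSet t ⊆ T ∧ T.Finite} +
      galtonWatsonLaw p {T | toSet t ⊆ T ∧ T.Infinite} =
        galtonWatsonLaw p {T | toSet t ⊆ T} :=
  measure_inter_add_sdiff {T | toSet t ⊆ T} measurableSet_finite

/-- The case of the trivial tree: p times the probability of a finite tree is 1 - p. -/
theorem mul_galtonWatsonLaw_infinite (hp : 1 / 2 < p) (hp1 : p < 1) :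
    ENNReal.ofReal p * galtonWatsonLaw p {T | T.Infinite} = ENNReal.ofReal (2 * p - 1) := by
  have hp0 : 0 < p := by linarith
  have hnil (s : ℕ∞) (ω : List Bool → ℝ) : toSet .nil ⊆ randomTree p s ω := by
    simpa [toSet] using nil_mem_randomTree
  have hroot : ∀ᵐ T ∂galtonWatsonLaw p, toSet .nil ⊆ T := by
    filter_upwards [ae_isPlaneTree_galtonWatsonLaw p] with T hT
    simpa [toSet] using hT.root_mem
  have h1 := galtonWatsonLaw_finite_add_infinite p .nil
  have h2 := mul_galtonWatsonLaw_finite hp0 hp1 .nil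
  have h3 : galtonWatsonLaw p {T | toSet .nil ⊆ T ∧ T.Infinite} =
      galtonWatsonLaw p {T | T.Infinite} := by
    refine measure_congr ?_
    filter_upwards [hroot] with T hT
    exact propext (and_iff_right hT)
  simp only [hnil, Set.ofPred_true, measure_univ, mul_one,
    tsum_ofReal_finiteSplitProb hp hp1] at h2
  rw [h3, galtonWatsonLaw_toSet_subset hp0 hp1, BinaryTree.numNodes, pow_zero] at h1
  have h4 := congrArg (ENNReal.ofReal p * ·) h1
  simp only [mul_add, h2, mul_one] at h4
  have h5 : ENNReal.ofReal p = ENNReal.ofReal (1 - p) + ENNReal.ofReal (2 * p - 1) := by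
    rw [← ENNReal.ofReal_add (by linarith) (by linarith)]
    congr 1
    ring
  exact (ENNReal.add_right_inj ENNReal.ofReal_ne_top).1 (h4.trans h5)

theorem uniformField_toSet_node_subset_top (hp : 1 / 2 < p) (hp1 : p < 1) (a b : BinaryTree Unit) :
    uniformField {ω | toSet (.node () a b) ⊆ randomTree p ⊤ ω} =
      ENNReal.ofReal p * galtonWatsonLaw p {T | toSet a ⊆ T ∧ T.Finite} *
        uniformField {ω | toSet b ⊆ randomTree p ⊤ ω} +
      ENNReal.ofReal p * galtonWatsonLaw p {T | toSet b ⊆ T ∧ T.Finite} *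
        uniformField {ω | toSet a ⊆ randomTree p ⊤ ω} +
      ENNReal.ofReal (2 * p - 1) * (uniformField {ω | toSet a ⊆ randomTree p ⊤ ω} *
        uniformField {ω | toSet b ⊆ randomTree p ⊤ ω}) := by
  have hp0 : 0 < p := by linarith
  rw [uniformField_toSet_node_subset hp0.le hp1.le (by simp),
    lintegral_split_top hp hp1 fun x => uniformField {ω | toSet a ⊆ randomTree p x.1 ω} *
      uniformField {ω | toSet b ⊆ randomTree p x.2 ω},
    mul_galtonWatsonLaw_finite hp0 hp1, mul_galtonWatsonLaw_finite hp0 hp1,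
    ← ENNReal.tsum_mul_right, ← ENNReal.tsum_mul_right]
  congr 2
  · exact tsum_congr fun n => (mul_assoc _ _ _).symm
  · exact tsum_congr fun n => by ring

/-- Both sides obey the same recursion over the binary tree: split p(F_a + I_a)(F_b + I_b) into
finite and infinite parts and remove p F_a F_b. -/
theorem galtonWatsonLaw_infinite (hp : 1 / 2 < p) (hp1 : p < 1) (t : BinaryTree Unit) :
    galtonWatsonLaw p {T | toSet t ⊆ T ∧ T.Infinite} =
      galtonWatsonLaw p {T | T.Infinite} * uniformField {ω | toSet t ⊆ randomTree p ⊤ ω} := by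
  have hp0 : 0 < p := by linarith
  have := isProbabilityMeasure_galtonWatsonLaw hp0 hp1
  induction t with
  | nil =>
    have hnil (ω : List Bool → ℝ) : toSet .nil ⊆ randomTree p ⊤ ω := by
      simpa [toSet] using nil_mem_randomTree
    simp only [hnil, Set.ofPred_true, measure_univ, mul_one]
    refine measure_congr ?_
    filter_upwards [ae_isPlaneTree_galtonWatsonLaw p] with T hT
    exact propext (and_iff_right (by simpa [toSet] using hT.root_mem))
  | node _ a b iha ihb =>
    have hab := galtonWatsonLaw_finite_add_infinite p (.node () a b)
    have ha := galtonWatsonLaw_finite_add_infinite p a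
    have hb := galtonWatsonLaw_finite_add_infinite p b
    have hfin : galtonWatsonLaw p {T | toSet (.node () a b) ⊆ T ∧ T.Finite} ≠ ⊤ :=
      measure_ne_top _ _
    rw [galtonWatsonLaw_toSet_subset hp0 hp1] at hab ha hb
    rw [uniformField_toSet_node_subset_top hp hp1, ← mul_galtonWatsonLaw_infinite hp hp1]
    -- Adding the finite part avoids subtraction in `ℝ≥0∞`; both sides then equal a power of p.
    refine (ENNReal.add_right_inj hfin).1 ?_
    rw [hab, BinaryTree.numNodes, pow_succ, pow_add, ← ha, ← hb,
      galtonWatsonLaw_finite_node hp0 hp1, iha, ihb]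
    ring

theorem galtonWatsonLaw_infinite_ne_zero (hp : 1 / 2 < p) (hp1 : p < 1) :
    galtonWatsonLaw p {T | T.Infinite} ≠ 0 := by
  intro h
  have := mul_galtonWatsonLaw_infinite hp hp1
  rw [h, mul_zero, eq_comm, ENNReal.ofReal_eq_zero] at this
  linarith

theorem cond_galtonWatsonLaw (hp : 1 / 2 < p) (hp1 : p < 1) :
    (galtonWatsonLaw p)[|{T : VertexSet | T.Infinite}] = uniformField.map (randomTree p ⊤) := by
  have hp0 : 0 < p := by linarith
  have := isProbabilityMeasure_galtonWatsonLaw hp0 hp1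
  have hmeas := measurable_randomTree hp0.le hp1.le ⊤
  refine ext_of_toSet_subset ?_ ?_ fun t => ?_
  · exact cond_absolutelyContinuous.ae_le (ae_isPlaneTree_galtonWatsonLaw p)
  · exact (ae_map_iff hmeas.aemeasurable measurableSet_isPlaneTree).2
      (ae_of_all _ (isPlaneTree_randomTree p ⊤))
  · have h : {T : VertexSet | T.Infinite} ∩ {T | toSet t ⊆ T} =
        {T | toSet t ⊆ T ∧ T.Infinite} := Set.inter_comm _ _
    rw [cond_apply measurableSet_infinite, h, galtonWatsonLaw_infinite hp hp1, ← mul_assoc,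
      ENNReal.inv_mul_cancel (galtonWatsonLaw_infinite_ne_zero hp hp1) (measure_ne_top _ _),
      one_mul, Measure.map_apply hmeas (measurableSet_toSet_subset t)]
    rfl

theorem randomTree_one_top (ω : List Bool → ℝ) : randomTree 1 ⊤ ω = Set.univ := by
  have htop (u : ℝ) : topSize 1 u = ⊤ := by
    by_contra h
    obtain ⟨l, hl⟩ := ENat.ne_top_iff_exists.1 h
    have := (topSize_eq_coe_iff zero_le_one le_rfl l).1 hl.symm
    simp [finiteSplitProb] at this
  have hmem (v : Vertex) (ω : List Bool → ℝ) : v ∈ randomTree 1 ⊤ ω := by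
    induction hn : v.sum + v.length using Nat.strong_induction_on generalizing v ω with
    | _ n ih =>
      rw [randomTree_of_ne_zero (by simp)]
      simp only [split_top, htop]
      match v with
      | [] => trivial
      | 0 :: w => exact ih _ (by simp at hn; omega) w _ rfl
      | (i + 1) :: w => exact ih _ (by simp at hn ⊢; omega) (i :: w) _ rfl
  exact Set.eq_univ_of_forall fun v => hmem v ω

end conditioned

/-! ### Luczak–Winkler couplings and the law of their union -/

section LuczakWinkler

variable {π : Measure (ℕ → VertexSet)}

theorem measurableSet_coord_subset (i j : ℕ) : MeasurableSet {T : ℕ → VertexSet | T i ⊆ T j} := by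
  have hmem (k : ℕ) (v : Vertex) : Measurable fun T : ℕ → VertexSet => v ∈ T k :=
    (measurable_set_mem v).comp (measurable_pi_apply k)
  simp only [Set.subset_def]
  rw [measurableSet_setOfPred]
  exact .forall fun v => (hmem i v).imp (hmem j v)

theorem measurable_iUnion_coord :
    Measurable fun T : ℕ → VertexSet => ⋃ (k : ℕ) (_ : 1 ≤ k), T k := by
  refine measurable_set_iff.2 fun v => ?_
  simp only [Set.mem_iUnion, exists_prop]
  exact .exists fun k => measurable_const.and ((measurable_set_mem v).comp (measurable_pi_apply k))

/-- The random trees with a finite number of vertices, built from the same labels. -/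
def finiteTrees (ω : List Bool → ℝ) (k : ℕ) : VertexSet := randomTree (1 / 2) ((k - 1 : ℕ) : ℕ∞) ω

theorem measurable_finiteTrees : Measurable finiteTrees :=
  measurable_pi_iff.2 fun k => measurable_randomTree (by norm_num) (by norm_num) _

theorem isLuczakWinklerCoupling_finiteTrees :
    IsLuczakWinklerCoupling (uniformField.map finiteTrees) where
  marginal k hk := by
    obtain ⟨n, rfl⟩ := Nat.exists_eq_add_of_le' hk
    rw [Measure.map_map (measurable_pi_apply _) measurable_finiteTrees,
      ← map_randomTree (p := 1 / 2) (by norm_num) (by norm_num) n]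
    rfl
  increasing := by
    refine ae_all_iff.2 fun k => ?_
    have h : ∀ᵐ T ∂uniformField.map finiteTrees, T k ⊆ T (k + 1) := by
      refine (ae_map_iff measurable_finiteTrees.aemeasurable
        (measurableSet_coord_subset k (k + 1))).2 (ae_of_all _ fun ω => ?_)
      exact randomTree_mono le_rfl le_rfl (by norm_num)
        (Nat.cast_le.2 (Nat.sub_le_sub_right (Nat.le_succ k) 1)) ω
    filter_upwards [h] with T hT _ using hT

theorem isProbabilityMeasure_uniformTreeLaw (n : ℕ) :
    IsProbabilityMeasure (uniformTreeLaw (n + 1)) := by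
  rw [← map_randomTree (p := 1 / 2) (by norm_num) (by norm_num)]
  exact Measure.isProbabilityMeasure_map
    (measurable_randomTree (by norm_num) (by norm_num) _).aemeasurable

theorem IsLuczakWinklerCoupling.isProbabilityMeasure (h : IsLuczakWinklerCoupling π) :
    IsProbabilityMeasure π := by
  have := isProbabilityMeasure_uniformTreeLaw 0
  have hπ := h.marginal 1 le_rfl
  refine ⟨?_⟩
  rw [← measure_univ (μ := uniformTreeLaw (0 + 1)), zero_add, ← hπ,
    Measure.map_apply (measurable_pi_apply 1) .univ, Set.preimage_univ]

/-- The law of the union of the trees of a Luczak-Winkler coupling does not depend on the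
coupling. -/
theorem IsLuczakWinklerCoupling.map_iUnion_apply (h : IsLuczakWinklerCoupling π)
    (F : Finset Vertex) :
    (π.map fun T => ⋃ (k : ℕ) (_ : 1 ≤ k), T k) {T | (F : VertexSet) ⊆ T} =
      ⨆ n : ℕ, uniformTreeLaw (n + 1) {T | (F : VertexSet) ⊆ T} := by
  -- Monotonicity of the trees is built into these events, so that they increase everywhere and not
  -- just almost surely.
  let S : ℕ → Set (ℕ → VertexSet) := fun n =>
    {T | (∀ k, 1 ≤ k → T k ⊆ T (k + 1)) ∧ (F : VertexSet) ⊆ T (n + 1)}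
  have hmono : Monotone S :=
    monotone_nat_of_le_succ fun n T hT => ⟨hT.1, hT.2.trans (hT.1 (n + 1) (by omega))⟩
  have hS (n : ℕ) : uniformTreeLaw (n + 1) {T | (F : VertexSet) ⊆ T} = π (S n) := by
    rw [← h.marginal (n + 1) (by omega),
      Measure.map_apply (measurable_pi_apply (n + 1)) (measurableSet_subset F)]
    refine measure_congr ?_
    filter_upwards [h.increasing] with T hT
    exact propext (and_iff_right hT).symm
  rw [Measure.map_apply measurable_iUnion_coord (measurableSet_subset F)]
  simp only [hS]
  rw [← hmono.measure_iUnion]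
  refine measure_congr ?_
  filter_upwards [h.increasing] with T hT
  have hT' : Monotone fun n => T (n + 1) := monotone_nat_of_le_succ fun n => hT (n + 1) (by omega)
  refine propext ⟨fun hF => ?_, fun hF => ?_⟩
  · have hF' : ∀ v ∈ F, ∃ n, v ∈ T (n + 1) := by
      intro v hv
      have := hF (Finset.mem_coe.2 hv)
      simp only [Set.mem_iUnion, exists_prop] at this
      obtain ⟨k, hk, hvk⟩ := this
      obtain ⟨n, rfl⟩ := Nat.exists_eq_add_of_le' hk
      exact ⟨n, hvk⟩
    choose! f hf using hF'
    exact Set.mem_iUnion.2 ⟨F.sup f, hT, fun v hv => hT' (Finset.le_sup hv) (hf v hv)⟩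
  · obtain ⟨n, -, hn⟩ := Set.mem_iUnion.1 hF
    exact hn.trans (Set.subset_biUnion_of_mem (u := T) (Nat.le_add_left 1 n))

theorem IsLuczakWinklerCoupling.map_iUnion_eq (h : IsLuczakWinklerCoupling π) :
    (π.map fun T => ⋃ (k : ℕ) (_ : 1 ≤ k), T k) =
      uniformField.map fun ω => ⋃ (k : ℕ) (_ : 1 ≤ k), finiteTrees ω k := by
  have := h.isProbabilityMeasure
  have h' := isLuczakWinklerCoupling_finiteTrees
  have hcomp : uniformField.map (fun ω => ⋃ (k : ℕ) (_ : 1 ≤ k), finiteTrees ω k) =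
      (uniformField.map finiteTrees).map fun T => ⋃ (k : ℕ) (_ : 1 ≤ k), T k :=
    (Measure.map_map measurable_iUnion_coord measurable_finiteTrees).symm
  rw [hcomp]
  exact ext_of_subset fun F => by rw [h.map_iUnion_apply, h'.map_iUnion_apply]

end LuczakWinkler

/-! ### The monotone coupling -/

section coupling

/-- The random tree with the law `𝒯_∞(p)`, built from the labels `ω`. -/
def infiniteTree (p : ℝ) (ω : List Bool → ℝ) : VertexSet :=
  if p = 1 / 2 then ⋃ (k : ℕ) (_ : 1 ≤ k), finiteTrees ω k else randomTree p ⊤ ω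

variable {p q : ℝ}

theorem measurable_infiniteTree (hp0 : 0 ≤ p) (hp1 : p ≤ 1) : Measurable (infiniteTree p) := by
  unfold infiniteTree
  split_ifs
  · exact measurable_iUnion_coord.comp measurable_finiteTrees
  · exact measurable_randomTree hp0 hp1 ⊤

theorem infiniteTree_mono (hp : 1 / 2 ≤ p) (hpq : p < q) (hq : q ≤ 1) (ω : List Bool → ℝ) :
    infiniteTree p ω ⊆ infiniteTree q ω := by
  unfold infiniteTree
  rw [if_neg (by linarith : q ≠ 1 / 2)]
  split_ifs with h
  -- Each finite tree was built with parameter 1/2 ≤ q and a size below `⊤`, from the same labels.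
  · exact Set.iUnion₂_subset fun k _ => randomTree_mono le_rfl (by linarith) hq le_top ω
  · exact randomTree_mono hp hpq.le hq le_rfl ω

/-- Every admissible law is the law of one explicit function of the labels, whichever Luczak–Winkler
coupling defines it; so one joint construction couples all of them. -/
theorem IsTInftyLaw.eq_map {ν : Measure VertexSet} (h : IsTInftyLaw p ν) :
    ν = uniformField.map (infiniteTree p) := by
  rcases h with ⟨rfl, π, hπ, rfl⟩ | ⟨hp, hp1, rfl⟩ | ⟨rfl, rfl⟩
  · have : infiniteTree (1 / 2) = fun ω => ⋃ (k : ℕ) (_ : 1 ≤ k), finiteTrees ω k := by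
      ext ω : 1
      exact if_pos rfl
    rw [this, hπ.map_iUnion_eq]
  · have : infiniteTree p = randomTree p ⊤ := by
      ext ω : 1
      exact if_neg hp.ne'
    rw [this, cond_galtonWatsonLaw hp hp1]
  · have : infiniteTree 1 = fun _ => Set.univ := by
      ext ω : 1
      rw [infiniteTree, if_neg (by norm_num), randomTree_one_top]
    rw [this, Measure.map_const, measure_univ, one_smul]

theorem exists_isTInftyLaw (hp : 1 / 2 ≤ p) (hp1 : p ≤ 1) : ∃ ν, IsTInftyLaw p ν := by
  rcases hp.eq_or_lt with h | h
  · exact ⟨_, Or.inl ⟨h.symm, _, isLuczakWinklerCoupling_finiteTrees, rfl⟩⟩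
  · rcases hp1.eq_or_lt with h1 | h1
    · exact ⟨_, Or.inr (Or.inr ⟨h1, rfl⟩)⟩
    · exact ⟨_, Or.inr (Or.inl ⟨h, h1, rfl⟩)⟩

theorem isMonotoneCoupling_infiniteTree (hp : 1 / 2 ≤ p) (hpq : p < q) (hq : q ≤ 1) :
    IsMonotoneCoupling (uniformField.map fun ω => (infiniteTree p ω, infiniteTree q ω))
      (uniformField.map (infiniteTree p)) (uniformField.map (infiniteTree q)) := by
  have h1 : Measurable (infiniteTree p) := measurable_infiniteTree (by linarith) (by linarith)
  have h2 : Measurable (infiniteTree q) := measurable_infiniteTree (by linarith) hq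
  refine ⟨Measure.isProbabilityMeasure_map (h1.prodMk h2).aemeasurable, ?_, ?_, ?_⟩
  · rw [Measure.map_map measurable_fst (h1.prodMk h2)]
    rfl
  · rw [Measure.map_map measurable_snd (h1.prodMk h2)]
    rfl
  · have hmeas : MeasurableSet {T : VertexSet × VertexSet | T.1 ⊆ T.2} := by
      simp only [Set.subset_def]
      rw [measurableSet_setOfPred]
      exact .forall fun v => ((measurable_set_mem v).comp measurable_fst).imp
        ((measurable_set_mem v).comp measurable_snd)
    exact (ae_map_iff (h1.prodMk h2).aemeasurable hmeas).2
      (ae_of_all _ (infiniteTree_mono hp hpq hq))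

end coupling

end GWTree

end

/-- The laws `𝒯_∞(p₁)` and `𝒯_∞(p₂)` exist (for `p = 1/2`: there is a Luczak-Winkler coupling), and
they have a monotone coupling, whichever Luczak-Winkler coupling is used for `p = 1/2`. -/
theorem theorem1p2 (p₁ p₂ : ℝ) (h₁ : 1 / 2 ≤ p₁) (h₁₂ : p₁ < p₂) (h₂ : p₂ ≤ 1) :
    (∃ ν₁ : Measure GWTree.VertexSet, GWTree.IsTInftyLaw p₁ ν₁) ∧
    (∃ ν₂ : Measure GWTree.VertexSet, GWTree.IsTInftyLaw p₂ ν₂) ∧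
    ∀ ν₁ ν₂ : Measure GWTree.VertexSet,
      GWTree.IsTInftyLaw p₁ ν₁ → GWTree.IsTInftyLaw p₂ ν₂ →
        ∃ γ : Measure (GWTree.VertexSet × GWTree.VertexSet),
          GWTree.IsMonotoneCoupling γ ν₁ ν₂ := by
  refine ⟨GWTree.exists_isTInftyLaw h₁ (by linarith), GWTree.exists_isTInftyLaw (by linarith) h₂,
    fun ν₁ ν₂ hν₁ hν₂ => ?_⟩
  rw [hν₁.eq_map, hν₂.eq_map]
  exact ⟨_, GWTree.isMonotoneCoupling_infiniteTree h₁ h₁₂ h₂⟩
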